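/- Let $\Gamma$ be a Conway 99-graph, i.e. a strongly regular graph with parameters $(99,14,1,2)$: a simple graph on $99$ vertices in which every vertex has exactly $14$ neighbors, any two adjacent vertices have exactly $1$ common neighbor, and any two distinct nonadjacent vertices have exactly $2$ common neighbors. Let $G=\mathrm{Aut}(\Gamma)$ be its automorphism group. If $7$ divides $|G|$, then $|G|$ divides $21$. -/

import Mathlib

/-! Counting modulo 7, with the pairing of the neighbours of a vertex by triangles, shows that an
automorphism `p` of order 7 fixes exactly one vertex v. Similar counts make every prime order above
7 act freely, hence equal 11. Order 5 and most fixed-point patterns of involutions die by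
integrality: a cyclic group contains the trivial character an integral number of times in the
eigenspace of the eigenvalue 3 (`dvd_sum_trace`).

The main step is that the group has odd order (`not_two_dvd_card`). An involution fixes one vertex
and swaps the two ends of every edge among its neighbours. Automorphisms preserve these edges and
are determined by their action on a fixed vertex and its neighbours, so an involution fixing v would
commute with `p` and give an element of order 14 fixing v. This is impossible
(`orderOf_ne_fourteen`): the 84 vertices at distance two from v form six regular orbits, and the 6 ×
6 orbit matrices obtained from the trivial and the sign character of `ZMod 14` satisfy contradictory
integer equations (`OrbitMatrices.false`). On the other hand, an involution is a product of 49
transpositions, hence odd, while a Sylow 7-subgroup consists of even permutations. The Frattini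
argument for the kernel of the sign then yields an involution normalizing the Sylow subgroup, which
must fix v.

In odd order, the stabilizer of v acts faithfully on an orbit of seven neighbours, so its order
divides 7! and is prime to 2 and 5; it divides 63, and 63 itself would make an element of order 3
commute with `p`. The orbit of v has length 1 or 99. Length 99 leaves two group orders, both with a
normal subgroup of order 11 containing a nontrivial element that commutes with `p`; this element
would fix v, although order 11 acts freely. -/

theorem Finset.card_modEq_card_filter_fixed {α : Type*} [DecidableEq α] {p : ℕ}
    [hp : Fact p.Prime] (f : α → α) (s : Finset α) (hs : ∀ x ∈ s, f x ∈ s)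
    (hf : ∀ x ∈ s, f^[p] x = x) :
    s.card ≡ (s.filter fun x => f x = x).card [MOD p] := by
  let F : Function.End s := fun x => ⟨f x, hs x x.2⟩
  have hval : ∀ n : ℕ, ∀ x : s, (((F ^ n) x : s) : α) = f^[n] x := by
    intro n
    induction n with
    | zero => intro x; rfl
    | succ k ih =>
      intro x
      rw [Function.iterate_succ_apply', ← ih, pow_succ']
      rfl
  have hF : F ^ p ^ 1 = 1 := by
    funext x
    apply Subtype.ext
    rw [pow_one, hval, hf x x.2]
    rfl
  have h := Equiv.Perm.card_fixedPoints_modEq hF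
  rw [Fintype.card_coe] at h
  refine h.trans ?_
  have e : Fintype.card (Function.fixedPoints F) = (s.filter fun x => f x = x).card := by
    rw [← Fintype.card_coe]
    refine Fintype.card_congr ⟨fun x => ⟨x.1.1, ?_⟩, fun x => ⟨⟨x.1, ?_⟩, ?_⟩, ?_, ?_⟩
    · have hx : F x.1 = x.1 := x.2
      exact Finset.mem_filter.2 ⟨x.1.2, congrArg Subtype.val hx⟩
    · exact (Finset.mem_filter.1 x.2).1
    · exact Subtype.ext (Finset.mem_filter.1 x.2).2
    · intro x; rfl
    · intro x; rfl
  rw [e]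

/-! ### Triangles, common neighbours and fixed-point congruences -/

namespace SimpleGraph

theorem iterate_iso {V : Type*} {Γ : SimpleGraph V} (g : Γ ≃g Γ) (n : ℕ) (x : V) : g^[n] x = (g ^ n) x := by
  induction n with
  | zero => rfl
  | succ k ih => rw [Function.iterate_succ_apply', ih, pow_succ']; rfl

section Conway

variable {V : Type*} [Fintype V] [DecidableEq V] {Γ : SimpleGraph V} [DecidableRel Γ.Adj]

theorem IsSRGWith.card_common {n k l m : ℕ} (h : Γ.IsSRGWith n k l m) (x y : V) :
    (Finset.univ.filter fun w => Γ.Adj x w ∧ Γ.Adj y w).card =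
      if x = y then k else if Γ.Adj x y then l else m := by
  have e : (Finset.univ.filter fun w => Γ.Adj x w ∧ Γ.Adj y w).card =
      Fintype.card (Γ.commonNeighbors x y) := by
    rw [← Set.toFinset_card]
    congr 1
    ext w
    simp [mem_commonNeighbors]
  split_ifs with h1 h2
  · subst h1
    simp only [and_self]
    rw [← h.regular.degree_eq x, ← card_neighborFinset_eq_degree]
    congr 1
    ext w
    simp
  · rw [e, h.of_adj _ _ h2]
  · rw [e, h.of_not_adj h1 h2]

theorem IsSRGWith.card_adj {n k l m : ℕ} (h : Γ.IsSRGWith n k l m) (x : V) :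
    (Finset.univ.filter fun w => Γ.Adj x w).card = k := by
  have := h.card_common x x
  simpa using this

theorem IsSRGWith.exists_third (h : Γ.IsSRGWith 99 14 1 2) {x y : V} (hxy : Γ.Adj x y) :
    ∃ z, ∀ w, (Γ.Adj x w ∧ Γ.Adj y w) ↔ w = z := by
  have := h.card_common x y
  rw [if_neg hxy.ne, if_pos hxy, Finset.card_eq_one] at this
  obtain ⟨z, hz⟩ := this
  refine ⟨z, fun w => ?_⟩
  have := Finset.ext_iff.1 hz w
  simpa using this

theorem IsSRGWith.exists_pair (h : Γ.IsSRGWith 99 14 1 2) {x y : V} (hne : x ≠ y)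
    (hxy : ¬ Γ.Adj x y) :
    ∃ a b, a ≠ b ∧ ∀ w, (Γ.Adj x w ∧ Γ.Adj y w) ↔ w = a ∨ w = b := by
  have := h.card_common x y
  rw [if_neg hne, if_neg hxy, Finset.card_eq_two] at this
  obtain ⟨a, b, hab, hz⟩ := this
  refine ⟨a, b, hab, fun w => ?_⟩
  have := Finset.ext_iff.1 hz w
  simpa using this

/-- In a triangle-partitioned neighbourhood, two common neighbours of adjacent vertices agree. -/
theorem IsSRGWith.third_unique (h : Γ.IsSRGWith 99 14 1 2) {x y z w : V} (hxy : Γ.Adj x y)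
    (h1 : Γ.Adj x z) (h2 : Γ.Adj y z) (h3 : Γ.Adj x w) (h4 : Γ.Adj y w) : z = w := by
  obtain ⟨u, hu⟩ := h.exists_third hxy
  rw [(hu z).1 ⟨h1, h2⟩, (hu w).1 ⟨h3, h4⟩]

/-- Nonadjacent vertices with two known common neighbours have no further ones. -/
theorem IsSRGWith.pair_unique (h : Γ.IsSRGWith 99 14 1 2) {x y a b w : V} (hne : x ≠ y)
    (hxy : ¬ Γ.Adj x y) (hab : a ≠ b) (h1 : Γ.Adj x a) (h2 : Γ.Adj y a) (h3 : Γ.Adj x b)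
    (h4 : Γ.Adj y b) (h5 : Γ.Adj x w) (h6 : Γ.Adj y w) : w = a ∨ w = b := by
  obtain ⟨c, d, hcd, hu⟩ := h.exists_pair hne hxy
  have ha := (hu a).1 ⟨h1, h2⟩
  have hb := (hu b).1 ⟨h3, h4⟩
  have hw := (hu w).1 ⟨h5, h6⟩
  grind

theorem IsSRGWith.exists_other (h : Γ.IsSRGWith 99 14 1 2) {x y a : V} (hne : x ≠ y)
    (hxy : ¬ Γ.Adj x y) (h1 : Γ.Adj x a) (h2 : Γ.Adj y a) :
    ∃ b, b ≠ a ∧ Γ.Adj x b ∧ Γ.Adj y b := by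
  obtain ⟨c, d, hcd, hu⟩ := h.exists_pair hne hxy
  have ha := (hu a).1 ⟨h1, h2⟩
  have hc := (hu c).2 (Or.inl rfl)
  have hd := (hu d).2 (Or.inr rfl)
  rcases ha with rfl | rfl
  · exact ⟨d, hcd.symm, hd⟩
  · exact ⟨c, hcd, hc⟩

/-- The entries of the square of the adjacency matrix. -/
theorem IsSRGWith.sum_adj_mul_adj (h : Γ.IsSRGWith 99 14 1 2) (x y : V) :
    ∑ w, (if Γ.Adj x w then (1 : ℤ) else 0) * (if Γ.Adj w y then 1 else 0) =
      12 * (if x = y then 1 else 0) + 2 - (if Γ.Adj x y then 1 else 0) := by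
  have h1 : ∑ w, (if Γ.Adj x w then (1 : ℤ) else 0) * (if Γ.Adj w y then 1 else 0) =
      ((Finset.univ.filter fun w => Γ.Adj x w ∧ Γ.Adj y w).card : ℤ) := by
    rw [Finset.card_filter]
    push_cast
    refine Finset.sum_congr rfl fun w _ => ?_
    by_cases h1 : Γ.Adj x w <;> by_cases h2 : Γ.Adj y w <;> simp [h1, h2, Γ.adj_comm w y]
  rw [h1, h.card_common x y]
  by_cases hxy : x = y
  · subst hxy; simp
  · by_cases h2 : Γ.Adj x y <;> simp [hxy, h2]

open Classical in
/-- The third vertex of the triangle on an edge (and the second vertex, off the edges). -/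
noncomputable def third (Γ : SimpleGraph V) (x y : V) : V :=
  if hz : ∃ z, Γ.Adj x z ∧ Γ.Adj y z then hz.choose else y

theorem IsSRGWith.third_spec (h : Γ.IsSRGWith 99 14 1 2) {x y : V} (hxy : Γ.Adj x y) :
    Γ.Adj x (Γ.third x y) ∧ Γ.Adj y (Γ.third x y) := by
  have hz : ∃ z, Γ.Adj x z ∧ Γ.Adj y z := by
    obtain ⟨z, hz⟩ := h.exists_third hxy
    exact ⟨z, (hz z).2 rfl⟩
  rw [third, dif_pos hz]
  exact hz.choose_spec

theorem IsSRGWith.third_eq (h : Γ.IsSRGWith 99 14 1 2) {x y z : V} (hxy : Γ.Adj x y)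
    (h1 : Γ.Adj x z) (h2 : Γ.Adj y z) : Γ.third x y = z :=
  h.third_unique hxy (h.third_spec hxy).1 (h.third_spec hxy).2 h1 h2

theorem IsSRGWith.third_third (h : Γ.IsSRGWith 99 14 1 2) {x y : V} (hxy : Γ.Adj x y) :
    Γ.third x (Γ.third x y) = y :=
  h.third_eq (h.third_spec hxy).1 hxy (h.third_spec hxy).2.symm

theorem IsSRGWith.map_third (h : Γ.IsSRGWith 99 14 1 2) (g : Γ ≃g Γ) {x y : V}
    (hxy : Γ.Adj x y) : g (Γ.third x y) = Γ.third (g x) (g y) :=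
  (h.third_eq (g.map_rel_iff.2 hxy) (g.map_rel_iff.2 (h.third_spec hxy).1)
    (g.map_rel_iff.2 (h.third_spec hxy).2)).symm

/-- The number of vertices fixed by an automorphism. -/
def fixedCount (g : Γ ≃g Γ) : ℕ := (Finset.univ.filter fun x => g x = x).card

/-- The number of vertices adjacent to their image under an automorphism. -/
def shiftCount (g : Γ ≃g Γ) : ℕ := (Finset.univ.filter fun x => Γ.Adj x (g x)).card

/-- The number of fixed neighbours of `v`. -/
def fixedDeg (g : Γ ≃g Γ) (v : V) : ℕ := (Finset.univ.filter fun x => Γ.Adj v x ∧ g x = x).card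

/-- Passing to the third vertex of the triangle on the edge to `v` is a fixed-point-free involution
of the fixed neighbours. -/
theorem IsSRGWith.even_fixedDeg (h : Γ.IsSRGWith 99 14 1 2) (g : Γ ≃g Γ) {v : V} (hv : g v = v) :
    Even (fixedDeg g v) := by
  have := Fact.mk Nat.prime_two
  have key := Finset.card_modEq_card_filter_fixed (p := 2) (fun x => Γ.third v x)
    (Finset.univ.filter fun x => Γ.Adj v x ∧ g x = x)
    (by
      intro x hx
      simp only [Finset.mem_filter, Finset.mem_univ, true_and] at hx ⊢
      refine ⟨(h.third_spec hx.1).1, ?_⟩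
      rw [h.map_third g hx.1, hv, hx.2])
    (by
      intro x hx
      simp only [Finset.mem_filter, Finset.mem_univ, true_and] at hx
      exact h.third_third hx.1)
  have h0 : ((Finset.univ.filter fun x => Γ.Adj v x ∧ g x = x).filter
      fun x => Γ.third v x = x) = ∅ := by
    ext x
    simp only [Finset.mem_filter, Finset.mem_univ, true_and, Finset.notMem_empty, iff_false,
      not_and]
    rintro ⟨hx, -⟩ h3
    exact (h.third_spec hx).2.ne h3.symm
  rw [h0, Finset.card_empty] at key
  exact Nat.even_iff.2 key

theorem IsSRGWith.fixedDeg_modEq (h : Γ.IsSRGWith 99 14 1 2) {p : ℕ} [Fact p.Prime] (g : Γ ≃g Γ)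
    (hg : g ^ p = 1) {v : V} (hv : g v = v) : 14 ≡ fixedDeg g v [MOD p] := by
  have key := Finset.card_modEq_card_filter_fixed (p := p) g
    (Finset.univ.filter fun x => Γ.Adj v x)
    (by
      intro x hx
      simp only [Finset.mem_filter, Finset.mem_univ, true_and] at hx ⊢
      have := g.map_rel_iff.2 hx
      rwa [hv] at this)
    (by
      intro x _
      rw [iterate_iso, hg]; rfl)
  rw [h.card_adj, Finset.filter_filter] at key
  exact key

theorem IsSRGWith.fixedCount_modEq (h : Γ.IsSRGWith 99 14 1 2) {p : ℕ} [Fact p.Prime] (g : Γ ≃g Γ)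
    (hg : g ^ p = 1) : 99 ≡ fixedCount g [MOD p] := by
  have key := Finset.card_modEq_card_filter_fixed (p := p) g Finset.univ
    (by simp)
    (by
      intro x _
      rw [iterate_iso, hg]; rfl)
  rw [Finset.card_univ, h.card] at key
  exact key

/-- An automorphism fixing a vertex and all its neighbours is trivial. -/
theorem IsSRGWith.eq_one_of_fix_neighbors (h : Γ.IsSRGWith 99 14 1 2) (g : Γ ≃g Γ) {v : V}
    (hv : g v = v) (hN : ∀ x, Γ.Adj v x → g x = x) : g = 1 := by
  ext w
  change g w = w
  by_cases hw : w = v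
  · rw [hw, hv]
  by_cases hvw : Γ.Adj v w
  · exact hN w hvw
  obtain ⟨a, b, hab, hu⟩ := h.exists_pair (Ne.symm hw) hvw
  have ha := (hu a).2 (Or.inl rfl)
  have hb := (hu b).2 (Or.inr rfl)
  have hnab : ¬ Γ.Adj a b := fun hadj =>
    hw (h.third_unique hadj ha.2.symm hb.2.symm ha.1.symm hb.1.symm)
  have h1 : Γ.Adj a (g w) := by
    have := g.map_rel_iff.2 ha.2.symm
    rwa [hN a ha.1] at this
  have h2 : Γ.Adj b (g w) := by
    have := g.map_rel_iff.2 hb.2.symm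
    rwa [hN b hb.1] at this
  -- The common neighbours of `a` and `b` are exactly `v` and `w`, so `g w` is one of them, and
  -- injectivity excludes `v`.
  rcases h.pair_unique hab hnab (Ne.symm hw) ha.1.symm hb.1.symm ha.2.symm hb.2.symm h1 h2
    with h3 | h3
  · exact absurd (g.injective (h3.trans hv.symm)) hw
  · exact h3

theorem IsSRGWith.eq_one_of_fixedDeg (h : Γ.IsSRGWith 99 14 1 2) (g : Γ ≃g Γ) {v : V}
    (hv : g v = v) (hd : fixedDeg g v = 14) : g = 1 := by
  apply h.eq_one_of_fix_neighbors g hv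
  have hs : (Finset.univ.filter fun x => Γ.Adj v x ∧ g x = x) ⊆
      (Finset.univ.filter fun x => Γ.Adj v x) := by
    intro x hx
    simp only [Finset.mem_filter, Finset.mem_univ, true_and] at hx ⊢
    exact hx.1
  have he := Finset.eq_of_subset_of_card_le hs (by rw [h.card_adj]; exact hd.ge)
  intro x hx
  have : x ∈ (Finset.univ.filter fun x => Γ.Adj v x) := by simpa using hx
  rw [← he] at this
  simp only [Finset.mem_filter, Finset.mem_univ, true_and] at this
  exact this.2

theorem IsSRGWith.fixedDeg_le (h : Γ.IsSRGWith 99 14 1 2) (g : Γ ≃g Γ) (v : V) :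
    fixedDeg g v ≤ 14 := by
  rw [← h.card_adj v]
  apply Finset.card_le_card
  intro x hx
  simp only [Finset.mem_filter, Finset.mem_univ, true_and] at hx ⊢
  exact hx.1

end Conway

end SimpleGraph

/-! ### Integrality of multiplicities on the eigenspace of 3 -/

theorem Matrix.exists_nat_trace_of_isIdempotentElem {n : Type*} [Fintype n] [DecidableEq n]
    {M : Matrix n n ℚ} (hM : IsIdempotentElem M) : ∃ r : ℕ, M.trace = r := by
  have h : IsIdempotentElem (Matrix.toLin' M) := by
    rw [IsIdempotentElem, Module.End.mul_eq_comp, ← Matrix.toLin'_mul, hM]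
  refine ⟨Module.finrank ℚ (LinearMap.range (Matrix.toLin' M)), ?_⟩
  -- The trace of a projection over ℚ is the dimension of its range.
  rw [← Matrix.trace_toLin'_eq, (LinearMap.IsIdempotentElem.isProj_range _ h).trace]

namespace SimpleGraph

section Trace

variable {V : Type*} [Fintype V] [DecidableEq V] {Γ : SimpleGraph V}

/-- The permutation matrix of a graph automorphism. -/
def isoMatrix (g : Γ ≃g Γ) : Matrix V V ℚ := Matrix.of fun x y => if g x = y then 1 else 0

theorem isoMatrix_mul_apply (g : Γ ≃g Γ) (M : Matrix V V ℚ) (x y : V) :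
    (isoMatrix g * M) x y = M (g x) y := by
  simp [Matrix.mul_apply, isoMatrix]

theorem mul_isoMatrix_apply (g : Γ ≃g Γ) (M : Matrix V V ℚ) (x y : V) :
    (M * isoMatrix g) x (g y) = M x y := by
  simp [Matrix.mul_apply, isoMatrix]

theorem isoMatrix_pow (g : Γ ≃g Γ) (n : ℕ) : isoMatrix g ^ n = isoMatrix (g ^ n) := by
  induction n with
  | zero => ext x y; simp [isoMatrix, Matrix.one_apply]
  | succ k ih =>
    ext x y
    rw [pow_succ', isoMatrix_mul_apply, ih, pow_succ]
    rfl

variable [DecidableRel Γ.Adj]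

/-- Seven times the projection onto the eigenspace of the eigenvalue `3`. -/
def eigenMatrix (Γ : SimpleGraph V) [DecidableRel Γ.Adj] : Matrix V V ℚ :=
  Matrix.of fun x y =>
    (if Γ.Adj x y then 1 else 0) + 4 * (if x = y then 1 else 0) - 2 / 11

theorem isoMatrix_mul_eigenMatrix (g : Γ ≃g Γ) :
    isoMatrix g * eigenMatrix Γ = eigenMatrix Γ * isoMatrix g := by
  ext x y
  obtain ⟨z, rfl⟩ := g.surjective y
  rw [isoMatrix_mul_apply, mul_isoMatrix_apply]
  simp [eigenMatrix, g.map_rel_iff]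

/-- The adjacency matrix A has eigenvalues 14, 3, -4 and satisfies A² + A - 12I = 2J. Adding 4I
kills the eigenspace of -4 and gives 7 on that of 3; subtracting (2/11)J kills the constants, since
14 + 4 = 99 · 2/11. -/
theorem IsSRGWith.eigenMatrix_mul_self (h : Γ.IsSRGWith 99 14 1 2) :
    eigenMatrix Γ * eigenMatrix Γ = (7 : ℚ) • eigenMatrix Γ := by
  ext x y
  rw [Matrix.mul_apply, Matrix.smul_apply]
  have h1 : ∑ w, (if Γ.Adj x w then (1 : ℚ) else 0) * (if Γ.Adj w y then 1 else 0) =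
      12 * (if x = y then 1 else 0) + 2 - (if Γ.Adj x y then 1 else 0) := by
    have := congrArg (Int.cast : ℤ → ℚ) (h.sum_adj_mul_adj x y)
    push_cast at this
    exact this
  have h2 : ∑ w, (if Γ.Adj x w then (1 : ℚ) else 0) = 14 := by
    rw [Finset.sum_boole, h.card_adj]; norm_num
  have h3 : ∑ w, (if Γ.Adj w y then (1 : ℚ) else 0) = 14 := by
    simp_rw [Γ.adj_comm _ y]
    rw [Finset.sum_boole, h.card_adj]; norm_num
  have h4 : ∑ w : V, (1 : ℚ) = 99 := by
    simp [h.card]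
  have h5 : ∑ w, (if x = w then (1 : ℚ) else 0) = 1 := by simp
  have h6 : ∑ w, (if w = y then (1 : ℚ) else 0) = 1 := by simp
  have h7 : ∑ w, (if x = w then (1 : ℚ) else 0) * (if w = y then 1 else 0) =
      if x = y then 1 else 0 := by simp
  have h8 : ∑ w, (if Γ.Adj x w then (1 : ℚ) else 0) * (if w = y then 1 else 0) =
      if Γ.Adj x y then 1 else 0 := by simp
  have h9 : ∑ w, (if x = w then (1 : ℚ) else 0) * (if Γ.Adj w y then 1 else 0) =
      if Γ.Adj x y then 1 else 0 := by
    simp only [ite_mul, one_mul, zero_mul, Finset.sum_ite_eq, Finset.mem_univ, if_true]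
  simp only [eigenMatrix, Matrix.of_apply]
  have expand : ∀ w, ((if Γ.Adj x w then (1 : ℚ) else 0) + 4 * (if x = w then 1 else 0) - 2 / 11) *
      ((if Γ.Adj w y then (1 : ℚ) else 0) + 4 * (if w = y then 1 else 0) - 2 / 11) =
      (if Γ.Adj x w then (1 : ℚ) else 0) * (if Γ.Adj w y then 1 else 0)
      + 4 * ((if Γ.Adj x w then (1 : ℚ) else 0) * (if w = y then 1 else 0))
      + 4 * ((if x = w then (1 : ℚ) else 0) * (if Γ.Adj w y then 1 else 0))
      + 16 * ((if x = w then (1 : ℚ) else 0) * (if w = y then 1 else 0))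
      - 2 / 11 * (if Γ.Adj x w then (1 : ℚ) else 0)
      - 2 / 11 * (if Γ.Adj w y then (1 : ℚ) else 0)
      - 8 / 11 * (if x = w then (1 : ℚ) else 0)
      - 8 / 11 * (if w = y then (1 : ℚ) else 0) + 4 / 121 * 1 := by
    intro w; ring
  rw [Finset.sum_congr rfl fun w _ => expand w]
  simp only [Finset.sum_add_distrib, Finset.sum_sub_distrib, ← Finset.mul_sum]
  rw [h1, h2, h3, h4, h5, h6, h7, h8, h9, smul_eq_mul]
  ring

theorem IsSRGWith.trace_isoMatrix_mul (h : Γ.IsSRGWith 99 14 1 2) (g : Γ ≃g Γ) :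
    (isoMatrix g * eigenMatrix Γ).trace = shiftCount g + 4 * fixedCount g - 18 := by
  simp only [Matrix.trace, Matrix.diag_apply, isoMatrix_mul_apply]
  simp only [eigenMatrix, Matrix.of_apply, Finset.sum_add_distrib, Finset.sum_sub_distrib,
    ← Finset.mul_sum, Finset.sum_boole, Finset.sum_const, Finset.card_univ, h.card, shiftCount,
    fixedCount, Γ.adj_comm (g _) _]
  norm_num

/-- The multiplicity of the trivial character of a cyclic group of automorphisms on the eigenspace
of the eigenvalue `3` is an integer. -/
theorem IsSRGWith.dvd_sum_trace (h : Γ.IsSRGWith 99 14 1 2) (g : Γ ≃g Γ) {n : ℕ} (hn : 0 < n)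
    (hg : g ^ n = 1) :
    (7 * n : ℤ) ∣ ∑ i ∈ Finset.range n,
      ((shiftCount (g ^ i) : ℤ) + 4 * fixedCount (g ^ i) - 18) := by
  set P := isoMatrix g with hP
  set M := eigenMatrix Γ with hM
  set S := ∑ i ∈ Finset.range n, P ^ i with hS
  have hPn : P ^ n = 1 := by rw [hP, isoMatrix_pow, hg, ← pow_zero g, ← isoMatrix_pow, pow_zero]
  have hPS : P * S = S := by
    have h1 := mul_neg_geom_sum P n
    rw [hPn, sub_self, sub_mul, one_mul, sub_eq_zero] at h1
    exact h1.symm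
  have hPi : ∀ i, P ^ i * S = S := by
    intro i
    induction i with
    | zero => simp
    | succ k ih => rw [pow_succ, mul_assoc, hPS, ih]
  have hSS : S * S = (n : ℚ) • S := by
    conv_lhs => rw [hS, Finset.sum_mul]
    rw [← hS, Finset.sum_congr rfl fun i _ => hPi i, Finset.sum_const, Finset.card_range,
      Nat.cast_smul_eq_nsmul]
  have hPM : Commute P M := isoMatrix_mul_eigenMatrix g
  have hSM : Commute S M := Commute.sum_left _ _ _ fun i _ => hPM.pow_left i
  have hn0 : (n : ℚ) ≠ 0 := by positivity
  -- `S / n` projects onto the vectors fixed by `g` and `M / 7` onto the eigenspace. They commute,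
  -- so the product is a projection, and its rank is the multiplicity in question.
  have hid : IsIdempotentElem ((1 / (7 * n : ℚ)) • (S * M)) := by
    rw [IsIdempotentElem, smul_mul_smul_comm, mul_assoc, ← mul_assoc M, ← hSM.eq, mul_assoc,
      h.eigenMatrix_mul_self, ← mul_assoc, hSS, smul_mul_smul_comm, smul_smul]
    congr 1
    field_simp
  obtain ⟨r, hr⟩ := Matrix.exists_nat_trace_of_isIdempotentElem hid
  refine ⟨r, ?_⟩
  rw [Matrix.trace_smul, hS, Finset.sum_mul, Matrix.trace_sum] at hr
  simp only [hP, isoMatrix_pow, hM, h.trace_isoMatrix_mul] at hr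
  rw [smul_eq_mul] at hr
  have : (∑ i ∈ Finset.range n,
      ((shiftCount (g ^ i) : ℚ) + 4 * fixedCount (g ^ i) - 18)) = 7 * n * r := by
    rw [← hr]; field_simp
  exact_mod_cast this

end Trace

end SimpleGraph

/-! ### Automorphisms of odd prime order -/

namespace SimpleGraph

theorem shiftCount_one {V : Type*} [Fintype V] {Γ : SimpleGraph V} [DecidableRel Γ.Adj] :
    shiftCount (1 : Γ ≃g Γ) = 0 := by
  simp [shiftCount]

section PrimeOrder

variable {V : Type*} [Fintype V] [DecidableEq V] {Γ : SimpleGraph V} [DecidableRel Γ.Adj]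

theorem IsSRGWith.fixedCount_one (h : Γ.IsSRGWith 99 14 1 2) :
    fixedCount (1 : Γ ≃g Γ) = 99 := by
  simp [fixedCount, h.card]

/-- For an automorphism of odd prime order, the common neighbours of two fixed vertices are
fixed. -/
theorem IsSRGWith.fixed_of_common (h : Γ.IsSRGWith 99 14 1 2) {p : ℕ} [hp : Fact p.Prime]
    (hp2 : p ≠ 2) (g : Γ ≃g Γ) (hg : g ^ p = 1) {x y w : V} (hx : g x = x) (hy : g y = y)
    (hne : x ≠ y) (h1 : Γ.Adj x w) (h2 : Γ.Adj y w) : g w = w := by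
  have h1' : Γ.Adj x (g w) := by
    have := g.map_rel_iff.2 h1
    rwa [hx] at this
  have h2' : Γ.Adj y (g w) := by
    have := g.map_rel_iff.2 h2
    rwa [hy] at this
  by_cases hxy : Γ.Adj x y
  · exact h.third_unique hxy h1' h2' h1 h2
  set s := Finset.univ.filter fun w => Γ.Adj x w ∧ Γ.Adj y w with hs
  have hcard : s.card = 2 := by
    rw [hs, h.card_common, if_neg hne, if_neg hxy]
  have key := Finset.card_modEq_card_filter_fixed (p := p) g s
    (by
      intro u hu
      simp only [hs, Finset.mem_filter, Finset.mem_univ, true_and] at hu ⊢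
      have h3 := g.map_rel_iff.2 hu.1
      have h4 := g.map_rel_iff.2 hu.2
      rw [hx] at h3
      rw [hy] at h4
      exact ⟨h3, h4⟩)
    (by
      intro u _
      rw [iterate_iso, hg]; rfl)
  have hp3 : 2 < p := lt_of_le_of_ne hp.out.two_le (Ne.symm hp2)
  have hle := Finset.card_filter_le s (fun x => g x = x)
  rw [hcard] at key hle
  -- At most two vertices are fixed, their number is 2 modulo `p`, and `p` exceeds 2: both common
  -- neighbours are fixed.
  have he := Nat.ModEq.eq_of_lt_of_lt key hp3 (by omega)
  have := Finset.filter_eq_self.1 (Finset.eq_of_subset_of_card_le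
    (Finset.filter_subset (fun x => g x = x) s) (by rw [hcard, ← he]))
  exact this w (by simp [hs, h1, h2])

/-- The number of fixed vertices is determined by walks of length two. -/
theorem IsSRGWith.sum_card_common (h : Γ.IsSRGWith 99 14 1 2) (g : Γ ≃g Γ) {v : V}
    (hv : g v = v) :
    ∑ w ∈ Finset.univ.filter (fun w => g w = w),
      ((Finset.univ.filter fun x => Γ.Adj v x ∧ Γ.Adj w x).card : ℤ) =
      2 * fixedCount g + 12 - fixedDeg g v := by
  have h1 : ∀ w, ((Finset.univ.filter fun x => Γ.Adj v x ∧ Γ.Adj w x).card : ℤ) =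
      2 + (if v = w then 12 else 0) - (if Γ.Adj v w then 1 else 0) := by
    intro w
    rw [h.card_common]
    by_cases h1 : v = w
    · subst h1; simp
    · by_cases h2 : Γ.Adj v w <;> simp [h1, h2]
  simp only [h1, Finset.sum_add_distrib, Finset.sum_sub_distrib, Finset.sum_const,
    Finset.sum_boole, Finset.filter_filter]
  rw [Finset.sum_ite_eq, if_pos (by simpa using hv)]
  simp only [fixedCount, fixedDeg, nsmul_eq_mul, and_comm (a := g _ = _)]
  ring

/-- The fixed degree is a multiple of 7, even, and not 14, hence 0. But two distinct fixed vertices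
are adjacent or have fixed common neighbours. -/
theorem IsSRGWith.eq_of_fixed_of_pow_seven (h : Γ.IsSRGWith 99 14 1 2) {g : Γ ≃g Γ}
    (hg : g ^ 7 = 1) (hg1 : g ≠ 1) {x y : V} (hx : g x = x) (hy : g y = y) : x = y := by
  have : Fact (Nat.Prime 7) := ⟨by norm_num⟩
  have h0 : fixedDeg g x = 0 := by
    have h1 := h.fixedDeg_modEq g hg hx
    have h2 := h.even_fixedDeg g hx
    have h3 := h.fixedDeg_le g x
    have h4 : fixedDeg g x ≠ 14 := fun h4 => hg1 (h.eq_one_of_fixedDeg g hx h4)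
    rw [Nat.ModEq] at h1
    rw [Nat.even_iff] at h2
    omega
  have h1 : ∀ w, Γ.Adj x w → g w ≠ w := by
    intro w hw hgw
    rw [fixedDeg, Finset.card_eq_zero] at h0
    have : w ∈ Finset.univ.filter fun z => Γ.Adj x z ∧ g z = z := by simp [hw, hgw]
    rw [h0] at this
    simp at this
  by_contra hne
  by_cases hxy : Γ.Adj x y
  · exact h1 y hxy hy
  · obtain ⟨a, b, -, hu⟩ := h.exists_pair hne hxy
    have ha := (hu a).2 (Or.inl rfl)
    exact h1 a ha.1 (h.fixed_of_common (p := 7) (by norm_num) g hg hx hy hne ha.1 ha.2)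

theorem IsSRGWith.exists_fixed_of_pow_seven (h : Γ.IsSRGWith 99 14 1 2) {g : Γ ≃g Γ}
    (hg : g ^ 7 = 1) : ∃ v, g v = v := by
  have : Fact (Nat.Prime 7) := ⟨by norm_num⟩
  have h1 := h.fixedCount_modEq g hg
  by_contra hcon
  push Not at hcon
  have : fixedCount g = 0 := by
    rw [fixedCount, Finset.card_eq_zero, Finset.filter_eq_empty_iff]
    intro x _
    exact hcon x
  rw [this] at h1
  exact absurd h1 (by decide)

/-- Automorphisms of prime order at least `11` have no fixed vertex. -/
theorem IsSRGWith.not_fixed_of_pow_prime (h : Γ.IsSRGWith 99 14 1 2) {p : ℕ} [hp : Fact p.Prime]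
    (hp7 : 7 < p) {g : Γ ≃g Γ} (hg : g ^ p = 1) (hg1 : g ≠ 1) (v : V) : g v ≠ v := by
  intro hv
  have h1 := h.fixedDeg_modEq g hg hv
  obtain ⟨k, hk⟩ := h.even_fixedDeg g hv
  have h3 := h.fixedDeg_le g v
  have h4 : fixedDeg g v ≠ 14 := fun h4 => hg1 (h.eq_one_of_fixedDeg g hv h4)
  have h5 : p ∣ 14 - fixedDeg g v := (Nat.modEq_iff_dvd' h3).1 h1.symm
  -- As `p` exceeds 7, this forces `k = 7`, i.e. all 14 neighbours fixed.
  have h6 : p ∣ 2 * (7 - k) := by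
    convert h5 using 1
    omega
  rcases (Nat.Prime.dvd_mul hp.out).1 h6 with h7 | h7
  · have := Nat.le_of_dvd (by norm_num) h7
    omega
  · have := Nat.le_of_dvd (by omega) h7
    omega

theorem IsSRGWith.prime_dvd_of_pow_prime (h : Γ.IsSRGWith 99 14 1 2) {p : ℕ} [hp : Fact p.Prime]
    (hp7 : 7 < p) {g : Γ ≃g Γ} (hg : g ^ p = 1) (hg1 : g ≠ 1) : p = 11 := by
  have h1 := h.fixedCount_modEq g hg
  have : fixedCount g = 0 := by
    rw [fixedCount, Finset.card_eq_zero, Finset.filter_eq_empty_iff]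
    intro x _
    exact h.not_fixed_of_pow_prime hp7 hg hg1 x
  rw [this] at h1
  have h2 : p ∣ 3 * 3 * 11 := (Nat.modEq_zero_iff_dvd).1 h1
  rcases (Nat.Prime.dvd_mul hp.out).1 h2 with h3 | h3
  · have := (Nat.Prime.dvd_mul hp.out).1 h3
    have := Nat.le_of_dvd (by norm_num) (or_self_iff.1 this)
    omega
  · exact (Nat.prime_dvd_prime_iff_eq hp.out (by norm_num)).1 h3

/-! ### Exclusion of order 5 -/

section OrderFive

theorem IsSRGWith.fixedDeg_of_pow_five (h : Γ.IsSRGWith 99 14 1 2) {g : Γ ≃g Γ}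
    (hg : g ^ 5 = 1) (hg1 : g ≠ 1) {x : V} (hx : g x = x) : fixedDeg g x = 4 := by
  have : Fact (Nat.Prime 5) := ⟨by norm_num⟩
  have h1 := h.fixedDeg_modEq g hg hx
  have h2 := h.even_fixedDeg g hx
  have h3 := h.fixedDeg_le g x
  have h4 : fixedDeg g x ≠ 14 := fun h4 => hg1 (h.eq_one_of_fixedDeg g hx h4)
  rw [Nat.ModEq] at h1
  rw [Nat.even_iff] at h2
  omega

/-- The fixed vertices induce a 4-regular subgraph containing all common neighbours of its distinct
vertices. Counting walks of length two from `v` gives 16 + 10 = 2n + 12 - 4. -/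
theorem IsSRGWith.fixedCount_of_pow_five (h : Γ.IsSRGWith 99 14 1 2) {g : Γ ≃g Γ}
    (hg : g ^ 5 = 1) (hg1 : g ≠ 1) : fixedCount g = 9 := by
  have : Fact (Nat.Prime 5) := ⟨by norm_num⟩
  have hmod := h.fixedCount_modEq g hg
  have hne : (Finset.univ.filter fun x => g x = x).Nonempty := by
    rw [← Finset.card_pos]
    change 0 < fixedCount g
    rw [Nat.ModEq] at hmod
    omega
  obtain ⟨v, hv⟩ := hne
  replace hv : g v = v := by simpa using hv
  have hsum := h.sum_card_common g hv
  set F := Finset.univ.filter (fun w => g w = w) with hF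
  -- Only for `w = v` do common neighbours leave the fixed subgraph: 14 - 4 = 10 of them.
  have e1 : ∀ w ∈ F, ((Finset.univ.filter fun x => Γ.Adj v x ∧ Γ.Adj w x).card : ℤ) =
      ((F.filter fun x => Γ.Adj v x ∧ Γ.Adj w x).card : ℤ) + if v = w then 10 else 0 := by
    intro w hw
    replace hw : g w = w := by simpa [hF] using hw
    by_cases hvw : v = w
    · subst hvw
      rw [if_pos rfl, h.card_common, if_pos rfl]
      have := h.fixedDeg_of_pow_five hg hg1 hv
      rw [fixedDeg] at this
      rw [hF, Finset.filter_filter]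
      simp only [and_self, and_comm (a := g _ = _)]
      rw [this]; norm_num
    · rw [if_neg hvw, add_zero]
      congr 2
      ext x
      simp only [hF, Finset.mem_filter, Finset.mem_univ, true_and]
      constructor
      · intro hx
        exact ⟨h.fixed_of_common (p := 5) (by norm_num) g hg hv hw hvw hx.1 hx.2, hx⟩
      · exact fun hx => hx.2
  rw [Finset.sum_congr rfl e1, Finset.sum_add_distrib, Finset.sum_ite_eq,
    if_pos (by simpa [hF] using hv)] at hsum
  have e2 : ∑ w ∈ F, ((F.filter fun x => Γ.Adj v x ∧ Γ.Adj w x).card : ℤ) = 16 := by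
    have e3 : ∀ w ∈ F, ((F.filter fun x => Γ.Adj v x ∧ Γ.Adj w x).card : ℤ) =
        ∑ x ∈ F.filter fun x => Γ.Adj v x, if Γ.Adj x w then 1 else 0 := by
      intro w _
      rw [Finset.sum_boole]
      simp only [Finset.filter_filter, Γ.adj_comm w]
    rw [Finset.sum_congr rfl e3, Finset.sum_comm]
    have e4 : ∀ x ∈ F.filter fun x => Γ.Adj v x, ∑ w ∈ F, (if Γ.Adj x w then (1 : ℤ) else 0) = 4 := by
      intro x hx
      have hx' : g x = x := by
        have := (Finset.mem_filter.1 hx).1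
        simpa [hF] using this
      have := h.fixedDeg_of_pow_five hg hg1 hx'
      rw [fixedDeg] at this
      rw [Finset.sum_boole, hF, Finset.filter_filter]
      simp only [and_comm (a := g _ = _)]
      rw [this]; norm_num
    rw [Finset.sum_congr rfl e4, Finset.sum_const]
    have := h.fixedDeg_of_pow_five hg hg1 hv
    rw [fixedDeg] at this
    rw [hF, Finset.filter_filter]
    simp only [and_comm (a := g _ = _)]
    rw [this]; norm_num
  rw [e2, h.fixedDeg_of_pow_five hg hg1 hv] at hsum
  push_cast at hsum
  omega

/-- The 9 fixed vertices send 10 edges each to the 90 others, none of which has two fixed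
neighbours; so each has exactly one. If `x` is adjacent to `g x`, the triangle on `x`, `g x` and
this fixed neighbour makes `g` swap `x` and `g x`, against odd order. -/
theorem IsSRGWith.shiftCount_of_pow_five (h : Γ.IsSRGWith 99 14 1 2) {g : Γ ≃g Γ}
    (hg : g ^ 5 = 1) (hg1 : g ≠ 1) : shiftCount g = 0 := by
  have hn := h.fixedCount_of_pow_five hg hg1
  rw [fixedCount] at hn
  set F := Finset.univ.filter (fun w => g w = w) with hF
  set N := Finset.univ.filter (fun w => ¬ g w = w) with hN
  have hFN : F.card + N.card = 99 := by
    rw [hF, hN, Finset.card_filter_add_card_filter_not, Finset.card_univ, h.card]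
  have hle : ∀ x ∈ N, (F.filter fun f => Γ.Adj f x).card ≤ 1 := by
    intro x hx
    rw [Finset.card_le_one]
    intro a ha b hb
    simp only [hF, hN, Finset.mem_filter, Finset.mem_univ, true_and] at ha hb hx
    by_contra hab
    have : Fact (Nat.Prime 5) := ⟨by norm_num⟩
    exact hx (h.fixed_of_common (p := 5) (by norm_num) g hg ha.1 hb.1 hab ha.2 hb.2)
  have hsum : ∑ x ∈ N, (F.filter fun f => Γ.Adj f x).card = ∑ x ∈ N, 1 := by
    have e1 : ∀ f ∈ F, ∑ x ∈ N, (if Γ.Adj f x then 1 else 0) = 10 := by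
      intro f hf
      replace hf : g f = f := by simpa [hF] using hf
      have h1 := h.fixedDeg_of_pow_five hg hg1 hf
      have h2 := h.card_adj f
      rw [← Finset.card_filter_add_card_filter_not (p := fun x => g x = x), Finset.filter_filter,
        Finset.filter_filter] at h2
      rw [Finset.sum_boole, hN, Finset.filter_filter]
      simp only [and_comm (a := ¬ g _ = _)]
      rw [fixedDeg] at h1
      simp only [Nat.cast_id]
      omega
    have e2 : ∀ x ∈ N, (F.filter fun f => Γ.Adj f x).card =
        ∑ f ∈ F, (if Γ.Adj f x then 1 else 0) := by
      intro x _
      rw [Finset.sum_boole]; rfl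
    rw [Finset.sum_congr rfl e2, Finset.sum_comm, Finset.sum_congr rfl e1]
    simp only [Finset.sum_const, smul_eq_mul]
    omega
  have heq := (Finset.sum_eq_sum_iff_of_le hle).1 hsum
  rw [shiftCount, Finset.card_eq_zero, Finset.filter_eq_empty_iff]
  intro x _ hx
  have hxN : x ∈ N := by simpa [hN] using hx.ne'
  obtain ⟨f, hf⟩ := Finset.card_pos.1 (by rw [heq x hxN]; norm_num)
  simp only [hF, Finset.mem_filter, Finset.mem_univ, true_and] at hf
  have h1 : Γ.Adj f (g x) := by
    have := g.map_rel_iff.2 hf.2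
    rwa [hf.1] at this
  have h2 := h.third_eq hf.2 h1 hx
  have h3 := h.map_third g hf.2
  rw [h2, hf.1, ← h2, h.third_third hf.2, h2] at h3
  have h4 : (g ^ 5) x = x := by rw [hg]; rfl
  have h5 : (g ^ 5) x = g (g (g (g (g x)))) := rfl
  rw [h5, h3, h3] at h4
  exact hx.ne h4.symm

theorem IsSRGWith.eq_one_of_pow_five (h : Γ.IsSRGWith 99 14 1 2) {g : Γ ≃g Γ}
    (hg : g ^ 5 = 1) : g = 1 := by
  by_contra hg1
  have h1 := h.dvd_sum_trace g (n := 5) (by norm_num) hg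
  have hpow : ∀ i ∈ ({1, 2, 3, 4} : Finset ℕ), shiftCount (g ^ i) = 0 ∧ fixedCount (g ^ i) = 9 := by
    intro i hi
    have h5 : (g ^ i) ^ 5 = 1 := by rw [← pow_mul, mul_comm, pow_mul, hg, one_pow]
    have hne : g ^ i ≠ 1 := by
      have ho : orderOf g = 5 := orderOf_eq_prime (hp := ⟨by norm_num⟩) hg hg1
      intro h6
      have := orderOf_dvd_of_pow_eq_one h6
      rw [ho] at this
      revert this hi
      revert i
      simp only [Finset.mem_insert, Finset.mem_singleton]
      rintro i - - hi
      rcases hi with rfl | rfl | rfl | rfl <;> norm_num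
    exact ⟨h.shiftCount_of_pow_five h5 hne, h.fixedCount_of_pow_five h5 hne⟩
  simp only [Finset.sum_range_succ, Finset.sum_range_zero, pow_zero, shiftCount_one,
    h.fixedCount_one] at h1
  rw [(hpow 1 (by simp)).1, (hpow 1 (by simp)).2, (hpow 2 (by simp)).1, (hpow 2 (by simp)).2,
    (hpow 3 (by simp)).1, (hpow 3 (by simp)).2, (hpow 4 (by simp)).1, (hpow 4 (by simp)).2] at h1
  -- The sum is 378 + 4 · 18 = 450, which is not a multiple of 35.
  norm_num at h1

end OrderFive

end PrimeOrder

end SimpleGraph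

/-! ### Fixed vertices of involutions -/

namespace SimpleGraph

section Involution

variable {V : Type*} [Fintype V] [DecidableEq V] {Γ : SimpleGraph V} [DecidableRel Γ.Adj]

/-- The number of neighbours of `v` that are adjacent to their image. -/
def flipDeg (g : Γ ≃g Γ) (v : V) : ℕ :=
  (Finset.univ.filter fun x => Γ.Adj v x ∧ Γ.Adj x (g x)).card

theorem IsSRGWith.fixedDeg_le_of_adj (h : Γ.IsSRGWith 99 14 1 2) {t : Γ ≃g Γ} {v a : V} (hv : t v = v) (ha : t a = a) (hva : Γ.Adj v a) :
    fixedDeg t v ≤ fixedDeg t a := by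
  have hav : a ∈ Finset.univ.filter fun x => Γ.Adj v x ∧ t x = x := by simp [hva, ha]
  have hva' : v ∈ Finset.univ.filter fun x => Γ.Adj a x ∧ t x = x := by simp [hva.symm, hv]
  rw [fixedDeg, fixedDeg, ← Finset.card_erase_add_one hav, ← Finset.card_erase_add_one hva']
  obtain ⟨c, hc⟩ := h.exists_third hva
  have hcadj := (hc c).2 rfl
  have htc : t c = c := by
    rw [← hc]
    have h1 := t.map_rel_iff.2 hcadj.1
    have h2 := t.map_rel_iff.2 hcadj.2
    rw [hv] at h1
    rw [ha] at h2
    exact ⟨h1, h2⟩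
  apply Nat.add_le_add_right
  -- A fixed neighbour `b` of `v` not adjacent to `a` is matched with the common neighbour of `a`
  -- and `b` other than `v`; the third vertex `c` of the triangle is matched with itself, whence the
  -- disjunct `b = w`.
  refine Finset.card_le_card_of_forall_subsingleton (fun b w => Γ.Adj b w ∨ b = w) ?_ ?_
  · intro b hb
    simp only [Finset.mem_erase, Finset.mem_filter, Finset.mem_univ, true_and] at hb
    obtain ⟨hba, hvb, htb⟩ := hb
    by_cases hbc : b = c
    · refine ⟨c, ?_, Or.inr hbc⟩
      simp only [Finset.mem_erase, Finset.mem_filter, Finset.mem_univ, true_and]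
      exact ⟨hcadj.1.ne', hcadj.2, htc⟩
    · have hnab : ¬ Γ.Adj a b := fun hab => hbc ((hc b).1 ⟨hvb, hab⟩)
      obtain ⟨w, hwv, haw, hbw⟩ := h.exists_other (Ne.symm hba) hnab hva.symm hvb.symm
      have htw : t w = w := by
        have h1 := t.map_rel_iff.2 haw
        have h2 := t.map_rel_iff.2 hbw
        rw [ha] at h1
        rw [htb] at h2
        rcases h.pair_unique (Ne.symm hba) hnab (Ne.symm hwv) hva.symm hvb.symm haw hbw h1 h2
          with h3 | h3
        · exact absurd (t.injective (h3.trans hv.symm)) hwv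
        · exact h3
      refine ⟨w, ?_, Or.inl hbw⟩
      simp only [Finset.mem_erase, Finset.mem_filter, Finset.mem_univ, true_and]
      exact ⟨hwv, haw, htw⟩
  · intro w hw
    simp only [Finset.mem_erase, Finset.mem_filter, Finset.mem_univ, true_and] at hw
    obtain ⟨hwv, haw, htw⟩ := hw
    have key : ∀ b, (b ≠ a ∧ Γ.Adj v b ∧ t b = b) ∧ (Γ.Adj b w ∨ b = w) →
        (w = c ∧ b = c) ∨ (w ≠ c ∧ Γ.Adj b w) := by
      rintro b ⟨⟨hba, hvb, htb⟩, hbw⟩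
      by_cases hwc : w = c
      · left
        refine ⟨hwc, ?_⟩
        rcases hbw with hbw | hbw
        · subst hwc
          exact absurd (h.third_unique hcadj.1 hvb hbw.symm hva hcadj.2.symm) hba
        · rw [hbw, hwc]
      · right
        refine ⟨hwc, ?_⟩
        rcases hbw with hbw | hbw
        · exact hbw
        · subst hbw
          exact absurd ((hc b).1 ⟨hvb, haw⟩) hwc
    intro b hb b' hb'
    simp only [Finset.mem_erase, Finset.mem_filter, Finset.mem_univ, true_and,
      Set.mem_ofPred_eq] at hb hb'
    rcases key b hb with h1 | h1 <;> rcases key b' hb' with h2 | h2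
    · rw [h1.2, h2.2]
    · exact absurd h1.1 h2.1
    · exact absurd h2.1 h1.1
    · have hnvw : ¬ Γ.Adj v w := fun hvw => h1.1 ((hc w).1 ⟨hvw, haw⟩)
      rcases h.pair_unique (Ne.symm hwv) hnvw (Ne.symm hb.1.1) hva haw.symm hb.1.2.1 h1.2.symm
        hb'.1.2.1 h2.2.symm with h3 | h3
      · exact absurd h3 hb'.1.1
      · exact h3.symm

theorem IsSRGWith.fixedDeg_eq_of_adj (h : Γ.IsSRGWith 99 14 1 2) {t : Γ ≃g Γ} {v a : V}
    (hv : t v = v) (ha : t a = a) (hva : Γ.Adj v a) :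
    fixedDeg t a = fixedDeg t v :=
  le_antisymm (h.fixedDeg_le_of_adj ha hv hva.symm) (h.fixedDeg_le_of_adj hv ha hva)

/-- The number of fixed neighbours of a neighbour of a fixed vertex. -/
theorem IsSRGWith.card_fixed_adj (h : Γ.IsSRGWith 99 14 1 2) {t : Γ ≃g Γ}
    (ht : ∀ x, t (t x) = x) {v x : V} (hv : t v = v) (hvx : Γ.Adj v x) :
    fixedDeg t x = if t x = x then fixedDeg t v else if Γ.Adj x (t x) then 1 else 2 := by
  have hvtx : Γ.Adj v (t x) := by
    have := t.map_rel_iff.2 hvx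
    rwa [hv] at this
  have htw : ∀ w, Γ.Adj x w → t w = w → Γ.Adj (t x) w := by
    intro w h1 h2
    have := t.map_rel_iff.2 h1
    rwa [h2] at this
  split_ifs with h1 h2
  · exact h.fixedDeg_eq_of_adj hv h1 hvx
  · rw [fixedDeg, Finset.card_eq_one]
    refine ⟨v, ?_⟩
    ext w
    simp only [Finset.mem_filter, Finset.mem_univ, true_and, Finset.mem_singleton]
    constructor
    · rintro ⟨h3, h4⟩
      exact h.third_unique h2 h3 (htw w h3 h4) hvx.symm hvtx.symm
    · rintro rfl
      exact ⟨hvx.symm, hv⟩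
  · obtain ⟨b, hbv, hxb, htxb⟩ := h.exists_other (Ne.symm h1) h2 hvx.symm hvtx.symm
    have htb : t b = b := by
      have h3 := t.map_rel_iff.2 hxb
      have h4 := t.map_rel_iff.2 htxb
      rw [ht] at h4
      rcases h.pair_unique (Ne.symm h1) h2 (Ne.symm hbv) hvx.symm hvtx.symm hxb htxb h4 h3
        with h5 | h5
      · exact absurd (t.injective (h5.trans hv.symm)) hbv
      · exact h5
    rw [fixedDeg, Finset.card_eq_two]
    refine ⟨v, b, Ne.symm hbv, ?_⟩
    ext w
    simp only [Finset.mem_filter, Finset.mem_univ, true_and, Finset.mem_insert,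
      Finset.mem_singleton]
    constructor
    · rintro ⟨h3, h4⟩
      exact h.pair_unique (Ne.symm h1) h2 (Ne.symm hbv) hvx.symm hvtx.symm hxb htxb h3
        (htw w h3 h4)
    · rintro (rfl | rfl)
      · exact ⟨hvx.symm, hv⟩
      · exact ⟨hxb, htb⟩

theorem IsSRGWith.fixedDeg_add_flipDeg_le (h : Γ.IsSRGWith 99 14 1 2) (t : Γ ≃g Γ) (v : V) :
    fixedDeg t v + flipDeg t v ≤ 14 := by
  rw [fixedDeg, flipDeg, ← Finset.card_union_of_disjoint, ← h.card_adj v]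
  · apply Finset.card_le_card
    intro x hx
    simp only [Finset.mem_union, Finset.mem_filter, Finset.mem_univ, true_and] at hx ⊢
    rcases hx with hx | hx <;> exact hx.1
  · rw [Finset.disjoint_left]
    intro x hx hx'
    simp only [Finset.mem_filter, Finset.mem_univ, true_and] at hx hx'
    exact hx'.2.ne hx.2.symm

/-- Walks of length two from `v` to fixed vertices, counted by their middle vertex: with d the fixed
and f the flip degree, there are d² + f + 2(14 - d - f) of them, against 2n + 12 - d counted by
endpoint. -/
theorem IsSRGWith.involution_local (h : Γ.IsSRGWith 99 14 1 2) {t : Γ ≃g Γ}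
    (ht : ∀ x, t (t x) = x) {v : V} (hv : t v = v) :
    2 * (fixedCount t : ℤ) + flipDeg t v = 16 + (fixedDeg t v : ℤ) ^ 2 - fixedDeg t v := by
  have hsum := h.sum_card_common t hv
  have e1 : ∀ w ∈ Finset.univ.filter (fun w => t w = w),
      ((Finset.univ.filter fun x => Γ.Adj v x ∧ Γ.Adj w x).card : ℤ) =
        ∑ x ∈ Finset.univ.filter (fun x => Γ.Adj v x), if Γ.Adj x w then 1 else 0 := by
    intro w _
    rw [Finset.sum_boole]
    simp only [Finset.filter_filter, Γ.adj_comm w]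
  rw [Finset.sum_congr rfl e1, Finset.sum_comm] at hsum
  have e2 : ∀ x ∈ Finset.univ.filter (fun x => Γ.Adj v x),
      ∑ w ∈ Finset.univ.filter (fun w => t w = w), (if Γ.Adj x w then (1 : ℤ) else 0) =
        2 + ((fixedDeg t v : ℤ) - 2) * (if t x = x then 1 else 0) -
          (if Γ.Adj x (t x) then 1 else 0) := by
    intro x hx
    replace hx : Γ.Adj v x := by simpa using hx
    rw [Finset.sum_boole, Finset.filter_filter]
    simp only [and_comm (a := t _ = _)]
    change (fixedDeg t x : ℤ) = _
    rw [h.card_fixed_adj ht hv hx]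
    by_cases h1 : t x = x
    · have h2 : ¬ Γ.Adj x (t x) := by rw [h1]; exact Γ.loopless.irrefl x
      simp [h1]
    · by_cases h2 : Γ.Adj x (t x) <;> simp [h1, h2]
  rw [Finset.sum_congr rfl e2, Finset.sum_sub_distrib, Finset.sum_add_distrib, ← Finset.mul_sum,
    Finset.sum_const, h.card_adj, Finset.sum_boole, Finset.sum_boole, Finset.filter_filter,
    Finset.filter_filter] at hsum
  change _ + _ * (fixedDeg t v : ℤ) - (flipDeg t v : ℤ) = _ at hsum
  simp only [nsmul_eq_mul] at hsum
  push_cast at hsum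
  linear_combination (-1 : ℤ) * hsum

/-- The third vertex of the triangle on an edge from `x` to `t x` is fixed, and it is the only fixed
neighbour of `x`. -/
theorem IsSRGWith.shiftCount_eq_sum_flipDeg (h : Γ.IsSRGWith 99 14 1 2) {t : Γ ≃g Γ}
    (ht : ∀ x, t (t x) = x) :
    shiftCount t = ∑ v ∈ Finset.univ.filter (fun v => t v = v), flipDeg t v := by
  have e1 : ∀ v ∈ Finset.univ.filter (fun v => t v = v), flipDeg t v =
      ∑ x ∈ Finset.univ.filter (fun x => Γ.Adj x (t x)), if Γ.Adj v x then 1 else 0 := by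
    intro v _
    rw [Finset.sum_boole, Finset.filter_filter, flipDeg]
    simp only [and_comm, Nat.cast_id]
  rw [Finset.sum_congr rfl e1, Finset.sum_comm, shiftCount, Finset.card_eq_sum_ones]
  refine Finset.sum_congr rfl fun x hx => ?_
  replace hx : Γ.Adj x (t x) := by simpa using hx
  rw [Finset.sum_boole, Finset.filter_filter]
  simp only [Nat.cast_id]
  symm
  rw [Finset.card_eq_one]
  obtain ⟨z, hz⟩ := h.exists_third hx
  have hz1 := (hz z).2 rfl
  refine ⟨z, ?_⟩
  ext w
  simp only [Finset.mem_filter, Finset.mem_univ, true_and, Finset.mem_singleton]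
  constructor
  · rintro ⟨h1, h2⟩
    rw [← hz]
    refine ⟨h2.symm, ?_⟩
    have := t.map_rel_iff.2 h2.symm
    rwa [h1] at this
  · rintro rfl
    refine ⟨?_, hz1.1.symm⟩
    rw [← hz]
    have h3 := t.map_rel_iff.2 hz1.1
    have h4 := t.map_rel_iff.2 hz1.2
    rw [ht] at h4
    exact ⟨h4, h3⟩

theorem IsSRGWith.shiftCount_add_fixedCount_le (h : Γ.IsSRGWith 99 14 1 2) (t : Γ ≃g Γ) :
    shiftCount t + fixedCount t ≤ 99 := by
  rw [fixedCount, shiftCount, ← Finset.card_union_of_disjoint, ← h.card]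
  · exact Finset.card_le_univ _
  · rw [Finset.disjoint_left]
    intro x hx hx'
    simp only [Finset.mem_filter, Finset.mem_univ, true_and] at hx hx'
    exact hx.ne hx'.symm

/-- The fixed edges of an automorphism are partitioned into fixed triangles. -/
theorem IsSRGWith.three_dvd_sum_fixedDeg (h : Γ.IsSRGWith 99 14 1 2) (t : Γ ≃g Γ) :
    3 ∣ ∑ v ∈ Finset.univ.filter (fun v => t v = v), fixedDeg t v := by
  have := Fact.mk Nat.prime_three
  set s : Finset (V × V) :=
    Finset.univ.filter fun q => (t q.1 = q.1 ∧ t q.2 = q.2) ∧ Γ.Adj q.1 q.2 with hs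
  -- The map rotates the ordered edges of each triangle, so it has order 3 and no fixed point.
  have key := Finset.card_modEq_card_filter_fixed (p := 3)
    (fun q : V × V => (q.2, Γ.third q.1 q.2)) s
    (by
      rintro ⟨x, y⟩ hq
      simp only [hs, Finset.mem_filter, Finset.mem_univ, true_and] at hq ⊢
      refine ⟨⟨hq.1.2, ?_⟩, (h.third_spec hq.2).2⟩
      rw [h.map_third t hq.2, hq.1.1, hq.1.2])
    (by
      rintro ⟨x, y⟩ hq
      simp only [hs, Finset.mem_filter, Finset.mem_univ, true_and] at hq
      have h1 := h.third_spec hq.2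
      have h2 : Γ.third y (Γ.third x y) = x := h.third_eq h1.2 hq.2.symm h1.1.symm
      simp only [Function.iterate_succ, Function.iterate_zero, Function.comp_apply, id]
      rw [h2, h.third_eq h1.1.symm h1.2.symm hq.2])
  have h0 : (s.filter fun q => (q.2, Γ.third q.1 q.2) = q) = ∅ := by
    rw [Finset.filter_eq_empty_iff]
    rintro ⟨x, y⟩ hq h1
    simp only [hs, Finset.mem_filter, Finset.mem_univ, true_and] at hq
    exact hq.2.ne (congrArg Prod.fst h1).symm
  rw [h0, Finset.card_empty] at key
  have hcard : ∑ v ∈ Finset.univ.filter (fun v => t v = v), fixedDeg t v = s.card := by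
    rw [hs, Finset.card_filter, ← Finset.univ_product_univ, Finset.sum_product, Finset.sum_filter]
    refine Finset.sum_congr rfl fun v _ => ?_
    by_cases hv : t v = v
    · rw [if_pos hv, fixedDeg, Finset.card_filter]
      simp only [hv, true_and, and_comm]
    · simp [hv]
  rw [hcard]
  exact (Nat.modEq_zero_iff_dvd).1 key

/-- A nontrivial involution has exactly one fixed vertex, and no edge at it is fixed. -/
theorem IsSRGWith.involution_fixedCount (h : Γ.IsSRGWith 99 14 1 2) {t : Γ ≃g Γ}
    (ht2 : t ^ 2 = 1) (ht1 : t ≠ 1) :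
    fixedCount t = 1 ∧ ∀ v, t v = v → flipDeg t v = 14 := by
  have ht : ∀ x, t (t x) = x := fun x => by
    have : (t ^ 2) x = x := by rw [ht2]; rfl
    exact this
  have := Fact.mk Nat.prime_two
  have hodd := h.fixedCount_modEq t ht2
  have htr := h.dvd_sum_trace t (n := 2) (by norm_num) ht2
  simp only [Finset.sum_range_succ, Finset.sum_range_zero, pow_zero, pow_one, shiftCount_one,
    h.fixedCount_one] at htr
  have hle := h.shiftCount_add_fixedCount_le t
  have h3 := h.three_dvd_sum_fixedDeg t
  have ha1 := h.shiftCount_eq_sum_flipDeg ht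
  have hn : fixedCount t = (Finset.univ.filter fun v => t v = v).card := rfl
  set F := Finset.univ.filter (fun v => t v = v) with hF
  set n := fixedCount t with hndef
  set a := shiftCount t with hadef
  have hloc : ∀ v ∈ F, ∃ k : ℕ, k ≤ 6 ∧ fixedDeg t v = 2 * k ∧
      2 * (n : ℤ) + flipDeg t v = 16 + 4 * (k : ℤ) ^ 2 - 2 * k ∧ 2 * k + flipDeg t v ≤ 14 := by
    intro v hv
    replace hv : t v = v := by simpa [hF] using hv
    obtain ⟨k, hk⟩ := h.even_fixedDeg t hv
    have h4 := h.fixedDeg_add_flipDeg_le t v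
    have h5 : fixedDeg t v ≠ 14 := fun h5 => ht1 (h.eq_one_of_fixedDeg t hv h5)
    have h6 := h.involution_local ht hv
    refine ⟨k, by omega, by omega, ?_, by omega⟩
    rw [hk] at h6
    push_cast at h6
    linear_combination h6
  -- For a given `n` the local equation allows few pairs of fixed and flip degree, and an affine
  -- function interpolates them. Summation expresses `a` through the total fixed degree and bounds
  -- the latter.
  have hlin : ∀ α β lo hi : ℤ, (∀ v ∈ F, (flipDeg t v : ℤ) = α + β * fixedDeg t v ∧
      lo ≤ fixedDeg t v ∧ (fixedDeg t v : ℤ) ≤ hi) →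
      (a : ℤ) = n * α + β * ((∑ v ∈ F, fixedDeg t v : ℕ) : ℤ) ∧
      n * lo ≤ ((∑ v ∈ F, fixedDeg t v : ℕ) : ℤ) ∧
      ((∑ v ∈ F, fixedDeg t v : ℕ) : ℤ) ≤ n * hi := by
    intro α β lo hi hv
    rw [ha1, hn]
    push_cast
    refine ⟨?_, ?_, ?_⟩
    · rw [Finset.sum_congr rfl fun v hv' => (hv v hv').1, Finset.sum_add_distrib,
        ← Finset.mul_sum, Finset.sum_const, nsmul_eq_mul]
    · rw [← nsmul_eq_mul]
      exact Finset.card_nsmul_le_sum _ _ _ fun v hv' => (hv v hv').2.1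
    · rw [← nsmul_eq_mul]
      exact Finset.sum_le_card_nsmul _ _ _ fun v hv' => (hv v hv').2.2
  have hne : F.Nonempty := by
    rw [← Finset.card_pos, ← hn]
    rw [Nat.ModEq] at hodd
    omega
  obtain ⟨v0, hv0⟩ := hne
  -- The odd `n` for which 2n + f = 16 + 4k² - 2k has a solution with `k ≤ 6` and `0 ≤ f ≤ 14 - 2k`.
  have hcase : n = 1 ∨ n = 3 ∨ n = 5 ∨ n = 7 ∨ n = 9 ∨ n = 11 ∨ n = 13 ∨ n = 19 ∨ n = 21 ∨
      n = 23 ∨ n = 33 ∨ n = 35 ∨ n = 51 ∨ n = 53 ∨ n = 73 := by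
    obtain ⟨k, hk, -, h5, h6⟩ := hloc v0 hv0
    rw [Nat.ModEq] at hodd
    interval_cases k <;> norm_num at h5 <;> omega
  have hd : ∀ α β lo hi : ℤ, (∀ k f : ℕ, k ≤ 6 → 2 * (n : ℤ) + f = 16 + 4 * (k : ℤ) ^ 2 - 2 * k →
      2 * k + f ≤ 14 → (f : ℤ) = α + β * (2 * k) ∧ lo ≤ 2 * k ∧ (2 * k : ℤ) ≤ hi) →
      ∀ v ∈ F, (flipDeg t v : ℤ) = α + β * fixedDeg t v ∧
      lo ≤ fixedDeg t v ∧ (fixedDeg t v : ℤ) ≤ hi := by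
    intro α β lo hi hyp v hv
    obtain ⟨k, hk, h4, h5, h6⟩ := hloc v hv
    have := hyp k _ hk h5 h6
    rw [h4]
    push_cast
    exact this
  clear hloc
  set D := ∑ v ∈ F, fixedDeg t v with hD
  have hn1 : n = 1 := by
    rcases hcase with hn' | hn' | hn' | hn' | hn' | hn' | hn' | hn' | hn' | hn' | hn' | hn' |
      hn' | hn' | hn'
    · exact hn'
    all_goals exfalso
    -- Integrality says that 14 divides 360 + a + 4n. For `n` from 3 to 9 this leaves only total
    -- fixed degrees not divisible by 3; from 11 on the flip degree is constant, and the
    -- divisibility or `a + n ≤ 99` fails.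
    · have := hlin 10 1 0 2 (hd _ _ _ _ (by
        intro k f hk h5 h6; rw [hn'] at h5; interval_cases k <;> norm_num at h5 ⊢ <;> omega))
      rw [hn'] at this htr; push_cast at this htr; omega
    · have := hlin 6 1 0 2 (hd _ _ _ _ (by
        intro k f hk h5 h6; rw [hn'] at h5; interval_cases k <;> norm_num at h5 ⊢ <;> omega))
      rw [hn'] at this htr; push_cast at this htr; omega
    · have := hlin 2 1 0 2 (hd _ _ _ _ (by
        intro k f hk h5 h6; rw [hn'] at h5; interval_cases k <;> norm_num at h5 ⊢ <;> omega))
      rw [hn'] at this htr; push_cast at this htr; omega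
    · have := hlin (-10) 5 2 4 (hd _ _ _ _ (by
        intro k f hk h5 h6; rw [hn'] at h5; interval_cases k <;> norm_num at h5 ⊢ <;> omega))
      rw [hn'] at this htr; push_cast at this htr; omega
    · have := hlin 6 0 0 14 (hd _ _ _ _ (by
        intro k f hk h5 h6; rw [hn'] at h5; interval_cases k <;> norm_num at h5 ⊢ <;> omega))
      rw [hn'] at this htr; push_cast at this htr; omega
    · have := hlin 2 0 0 14 (hd _ _ _ _ (by
        intro k f hk h5 h6; rw [hn'] at h5; interval_cases k <;> norm_num at h5 ⊢ <;> omega))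
      rw [hn'] at this htr; push_cast at this htr; omega
    · have := hlin 8 0 0 14 (hd _ _ _ _ (by
        intro k f hk h5 h6; rw [hn'] at h5; interval_cases k <;> norm_num at h5 ⊢ <;> omega))
      rw [hn'] at this htr; push_cast at this htr; omega
    · have := hlin 4 0 0 14 (hd _ _ _ _ (by
        intro k f hk h5 h6; rw [hn'] at h5; interval_cases k <;> norm_num at h5 ⊢ <;> omega))
      rw [hn'] at this htr; push_cast at this htr; omega
    · have := hlin 0 0 0 14 (hd _ _ _ _ (by
        intro k f hk h5 h6; rw [hn'] at h5; interval_cases k <;> norm_num at h5 ⊢ <;> omega))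
      rw [hn'] at this htr; push_cast at this htr; omega
    · have := hlin 6 0 0 14 (hd _ _ _ _ (by
        intro k f hk h5 h6; rw [hn'] at h5; interval_cases k <;> norm_num at h5 ⊢ <;> omega))
      rw [hn'] at this htr; push_cast at this htr; omega
    · have := hlin 2 0 0 14 (hd _ _ _ _ (by
        intro k f hk h5 h6; rw [hn'] at h5; interval_cases k <;> norm_num at h5 ⊢ <;> omega))
      rw [hn'] at this htr; push_cast at this htr; omega
    · have := hlin 4 0 0 14 (hd _ _ _ _ (by
        intro k f hk h5 h6; rw [hn'] at h5; interval_cases k <;> norm_num at h5 ⊢ <;> omega))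
      rw [hn'] at this htr; push_cast at this htr; omega
    · have := hlin 0 0 0 14 (hd _ _ _ _ (by
        intro k f hk h5 h6; rw [hn'] at h5; interval_cases k <;> norm_num at h5 ⊢ <;> omega))
      rw [hn'] at this htr; push_cast at this htr; omega
    · have := hlin 2 0 0 14 (hd _ _ _ _ (by
        intro k f hk h5 h6; rw [hn'] at h5; interval_cases k <;> norm_num at h5 ⊢ <;> omega))
      rw [hn'] at this htr; push_cast at this htr; omega
  refine ⟨hn1, fun v hv => ?_⟩
  have := hd 14 0 0 14 (by
    intro k f hk h5 h6; rw [hn1] at h5; interval_cases k <;> norm_num at h5 ⊢ <;> omega) v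
    (by simpa [hF] using hv)
  have h7 := this.1
  norm_num at h7
  exact_mod_cast h7

end Involution

end SimpleGraph

/-! ### Orbits of an automorphism of order 14 and twisted orbit matrices -/

namespace SimpleGraph

section OrderFourteen

variable {V : Type*} {Γ : SimpleGraph V}

/-- An action of `ZMod 14` by automorphisms, free away from the fixed vertex `v`, in which the
involution flips exactly the edges at `v`. -/
structure FlipAction (Γ : SimpleGraph V) (γ : ZMod 14 → Γ ≃g Γ) (v : V) : Prop where
  add : ∀ i j x, γ (i + j) x = γ i (γ j x)
  zero : ∀ x, γ 0 x = x
  fix : ∀ i, γ i v = v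
  free : ∀ i x, γ i x = x → i = 0 ∨ x = v
  flip : ∀ x, Γ.Adj v x ↔ Γ.Adj x (γ 7 x)

/-- The differences labelling the orbits at distance two from the fixed vertex. -/
def orbitDiff : Fin 6 → ZMod 14 := ![2, 4, 6, 1, 3, 5]

theorem orbitDiff_ne_zero : ∀ k, orbitDiff k ≠ 0 := by decide

theorem orbitDiff_ne_seven : ∀ k, orbitDiff k ≠ 7 := by decide

/-- Orbit representatives for a `FlipAction`. -/
structure FlipFrame (Γ : SimpleGraph V) (γ : ZMod 14 → Γ ≃g Γ) (v a : V) (z : Fin 6 → V) : Prop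
    extends FlipAction Γ γ v where
  adj_a : Γ.Adj v a
  ne_v : ∀ k, z k ≠ v
  adj_z : ∀ k i, Γ.Adj (z k) (γ i a) ↔ i = 0 ∨ i = orbitDiff k

namespace FlipAction

variable {γ : ZMod 14 → Γ ≃g Γ} {v : V}

theorem neg_apply (H : FlipAction Γ γ v) (i : ZMod 14) (x : V) : γ (-i) (γ i x) = x := by
  rw [← H.add, neg_add_cancel, H.zero]

theorem adj_iff (H : FlipAction Γ γ v) (i j : ZMod 14) (x y : V) :
    Γ.Adj (γ i x) (γ j y) ↔ Γ.Adj x (γ (j - i) y) := by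
  rw [← (γ (-i)).map_rel_iff, H.neg_apply, ← H.add, neg_add_eq_sub]

theorem adj_v (H : FlipAction Γ γ v) (i : ZMod 14) (x : V) : Γ.Adj v (γ i x) ↔ Γ.Adj v x := by
  conv_lhs => rw [← H.fix i]
  exact (γ i).map_rel_iff

theorem eq_of_apply_eq (H : FlipAction Γ γ v) {i j : ZMod 14} {x : V} (hx : x ≠ v)
    (hij : γ i x = γ j x) : i = j := by
  have h1 : γ (-j + i) x = x := by rw [H.add, hij, H.neg_apply]
  rcases H.free _ _ h1 with h2 | h2
  · rw [neg_add_eq_sub, sub_eq_zero] at h2; exact h2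
  · exact absurd h2 hx

variable [Fintype V] [DecidableEq V] [DecidableRel Γ.Adj]

theorem adj_v_iff (H : FlipAction Γ γ v) (h : Γ.IsSRGWith 99 14 1 2) {a : V} (ha : Γ.Adj v a)
    (x : V) : Γ.Adj v x ↔ ∃ i, x = γ i a := by
  have hs : (Finset.univ.image fun i => γ i a) ⊆ Finset.univ.filter fun x => Γ.Adj v x := by
    intro x hx
    obtain ⟨i, -, rfl⟩ := Finset.mem_image.1 hx
    simpa using (H.adj_v i a).2 ha
  have heq := Finset.eq_of_subset_of_card_le hs (by
    rw [h.card_adj, Finset.card_image_of_injective _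
      (fun i j hij => H.eq_of_apply_eq ha.ne' hij), Finset.card_univ, ZMod.card])
  have := Finset.ext_iff.1 heq x
  simp only [Finset.mem_image, Finset.mem_univ, true_and, Finset.mem_filter] at this
  rw [← this]
  exact ⟨fun ⟨i, hi⟩ => ⟨i, hi.symm⟩, fun ⟨i, hi⟩ => ⟨i, hi.symm⟩⟩

theorem adj_a_iff (H : FlipAction Γ γ v) (h : Γ.IsSRGWith 99 14 1 2) {a : V} (ha : Γ.Adj v a)
    (i : ZMod 14) : Γ.Adj a (γ i a) ↔ i = 7 := by
  constructor
  · intro hi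
    have := h.third_unique ha ((H.adj_v i a).2 ha) hi ((H.adj_v 7 a).2 ha) ((H.flip a).1 ha)
    exact H.eq_of_apply_eq ha.ne' this
  · rintro rfl
    exact (H.flip a).1 ha

/-- Vertices at distance two from `v` correspond to nonadjacent pairs of neighbours of `v`. Up to
rotation such a pair is given by its difference up to sign, which is neither 0 nor 7: six orbits. -/
theorem exists_frame (H : FlipAction Γ γ v) (h : Γ.IsSRGWith 99 14 1 2) :
    ∃ a z, FlipFrame Γ γ v a z := by
  obtain ⟨a, ha⟩ : ∃ a, Γ.Adj v a := by
    have := h.card_adj v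
    obtain ⟨a, ha⟩ := Finset.card_pos.1 (by rw [this]; norm_num)
    exact ⟨a, by simpa using ha⟩
  have hz : ∀ k : Fin 6, ∃ z, z ≠ v ∧ Γ.Adj a z ∧ Γ.Adj (γ (orbitDiff k) a) z := by
    intro k
    apply h.exists_other _ _ ha.symm ((H.adj_v _ a).2 ha).symm
    · intro h1
      rcases H.free _ _ h1.symm with h2 | h2
      · exact orbitDiff_ne_zero k h2
      · exact ha.ne' h2
    · rw [H.adj_a_iff h ha]
      exact orbitDiff_ne_seven k
  choose z hz1 hz2 hz3 using hz
  refine ⟨a, z, H, ha, hz1, fun k i => ?_⟩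
  have hva := (H.adj_v (orbitDiff k) a).2 ha
  have hne : γ (orbitDiff k) a ≠ a := by
    intro h1
    rcases H.free _ _ h1 with h2 | h2
    · exact orbitDiff_ne_zero k h2
    · exact ha.ne' h2
  have hnv : ¬ Γ.Adj v (z k) := by
    intro h1
    have h2 := (H.adj_v_iff h ha (z k)).1 h1
    obtain ⟨j, hj⟩ := h2
    have h3 := hz2 k
    rw [hj, H.adj_a_iff h ha] at h3
    have h4 := hz3 k
    rw [hj, H.adj_iff, H.adj_a_iff h ha, h3] at h4
    exact orbitDiff_ne_zero k (by linear_combination -h4)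
  constructor
  · intro hi
    rcases h.pair_unique (Ne.symm (hz1 k)) hnv (Ne.symm hne) ha (hz2 k).symm hva (hz3 k).symm
      ((H.adj_v i a).2 ha) hi with h1 | h1
    · left
      exact H.eq_of_apply_eq ha.ne' (h1.trans (H.zero a).symm)
    · right
      exact H.eq_of_apply_eq ha.ne' h1
  · rintro (rfl | rfl)
    · rw [H.zero]; exact (hz2 k).symm
    · exact (hz3 k).symm

end FlipAction

namespace FlipFrame

variable {γ : ZMod 14 → Γ ≃g Γ} {v a : V} {z : Fin 6 → V}

/-- The pair of neighbours shared with `v` recovers both the orbit and the position in it: the sets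
`{0, orbitDiff j}` have no coincidences under translation. -/
theorem apply_z_eq (H : FlipFrame Γ γ v a z) {j k : Fin 6} {i : ZMod 14}
    (hjk : z j = γ i (z k)) : j = k ∧ i = 0 := by
  have key : ∀ m : ZMod 14, (m = 0 ∨ m = orbitDiff j) ↔ (m - i = 0 ∨ m - i = orbitDiff k) := by
    intro m
    rw [← H.adj_z j, ← H.adj_z k, hjk, H.adj_iff]
  have : ∀ j k : Fin 6, ∀ i : ZMod 14,
      (∀ m : ZMod 14, (m = 0 ∨ m = orbitDiff j) ↔ (m - i = 0 ∨ m - i = orbitDiff k)) →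
      j = k ∧ i = 0 := by decide
  exact this j k i key

variable [Fintype V] [DecidableEq V] [DecidableRel Γ.Adj]

theorem not_adj_v (H : FlipFrame Γ γ v a z) (h : Γ.IsSRGWith 99 14 1 2) (k : Fin 6) :
    ¬ Γ.Adj v (z k) := by
  intro h1
  obtain ⟨j, hj⟩ := (H.adj_v_iff h H.adj_a (z k)).1 h1
  have h2 := (H.adj_z k 0).2 (Or.inl rfl)
  have h3 := (H.adj_z k _).2 (Or.inr rfl)
  rw [hj, H.adj_iff, H.adj_a_iff h H.adj_a] at h2 h3
  exact orbitDiff_ne_zero k (by linear_combination h3 - h2)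

/-- The orbits found so far are disjoint and regular off `v`, and 1 + 14 + 6 · 14 = 99, so nothing
is missing. -/
theorem sum_eq (H : FlipFrame Γ γ v a z) (h : Γ.IsSRGWith 99 14 1 2) (F : V → ℤ) :
    ∑ x, F x = F v + ∑ i, F (γ i a) + ∑ l, ∑ i, F (γ i (z l)) := by
  let f : Unit ⊕ ZMod 14 ⊕ (Fin 6 × ZMod 14) → V :=
    Sum.elim (fun _ => v) (Sum.elim (fun i => γ i a) (fun q => γ q.2 (z q.1)))
  have hnv : ∀ k i, ¬ Γ.Adj v (γ i (z k)) := fun k i => by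
    rw [H.adj_v]; exact H.not_adj_v h k
  have hinj : Function.Injective f := by
    rintro (_ | i | ⟨k, i⟩) (_ | j | ⟨l, j⟩) hij <;>
      simp only [f, Sum.elim_inl, Sum.elim_inr] at hij
    · rfl
    · exact absurd ((H.adj_v j a).2 H.adj_a) (by rw [← hij]; exact Γ.loopless.irrefl v)
    · rw [← H.fix j] at hij
      exact absurd ((γ j).injective hij).symm (H.ne_v l)
    · exact absurd ((H.adj_v i a).2 H.adj_a) (by rw [hij]; exact Γ.loopless.irrefl v)
    · rw [H.eq_of_apply_eq H.adj_a.ne' hij]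
    · exact absurd ((H.adj_v i a).2 H.adj_a) (by rw [hij]; exact hnv _ _)
    · rw [← H.fix i] at hij
      exact absurd ((γ i).injective hij) (H.ne_v k)
    · exact absurd ((H.adj_v j a).2 H.adj_a) (by rw [← hij]; exact hnv _ _)
    · have h1 : z k = γ (-i + j) (z l) := by rw [H.add, ← hij, H.neg_apply]
      obtain ⟨rfl, h2⟩ := H.apply_z_eq h1
      rw [neg_add_eq_sub, sub_eq_zero] at h2
      rw [h2]
  have hbij : Function.Bijective f := by
    rw [Fintype.bijective_iff_injective_and_card]
    refine ⟨hinj, ?_⟩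
    simp [h.card, ZMod.card]
  rw [← hbij.sum_comp F, Fintype.sum_sum_type, Fintype.sum_sum_type, Fintype.sum_prod_type]
  simp [f, add_assoc]

end FlipFrame

/-- A character turns convolution into a product; this reduces the block-circulant adjacency matrix
to one entry per pair of orbits. -/
theorem sum_mul_conv {G : Type*} [AddCommGroup G] [Fintype G] (χ p q : G → ℤ)
    (hχ : ∀ i j, χ (i + j) = χ i * χ j) :
    ∑ i, χ i * ∑ m, p m * q (i - m) = (∑ i, χ i * p i) * ∑ i, χ i * q i := by
  rw [Finset.sum_mul]
  simp only [Finset.mul_sum]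
  rw [Finset.sum_comm]
  refine Finset.sum_congr rfl fun m _ => ?_
  rw [ ← Equiv.sum_comp (Equiv.addRight m)]
  refine Finset.sum_congr rfl fun i _ => ?_
  simp only [Equiv.coe_addRight, add_sub_cancel_right, hχ]
  ring

variable [DecidableRel Γ.Adj]

/-- The adjacency indicator of `x` and the `i`-th translate of `y`. -/
def adjInd (γ : ZMod 14 → Γ ≃g Γ) (x y : V) (i : ZMod 14) : ℤ := if Γ.Adj x (γ i y) then 1 else 0

/-- The entry of the orbit matrix twisted by `χ`. -/
def twist (γ : ZMod 14 → Γ ≃g Γ) (χ : ZMod 14 → ℤ) (x y : V) : ℤ := ∑ i, χ i * adjInd γ x y i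

namespace FlipFrame

variable {γ : ZMod 14 → Γ ≃g Γ} {v a : V} {z : Fin 6 → V} {χ : ZMod 14 → ℤ}

theorem adjInd_symm (H : FlipFrame Γ γ v a z) (x y : V) (i : ZMod 14) :
    adjInd γ x y i = adjInd γ y x (-i) := by
  have : Γ.Adj x (γ i y) ↔ Γ.Adj y (γ (-i) x) := by
    rw [← (γ (-i)).map_rel_iff, H.neg_apply, Γ.adj_comm]
  simp only [adjInd, this]

theorem twist_symm (H : FlipFrame Γ γ v a z) (hχn : ∀ i, χ (-i) = χ i) (x y : V) :
    twist γ χ x y = twist γ χ y x := by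
  rw [twist, twist, ← Equiv.sum_comp (Equiv.neg (ZMod 14))]
  refine Finset.sum_congr rfl fun i _ => ?_
  rw [Equiv.neg_apply, hχn, H.adjInd_symm x y, neg_neg]

theorem twist_z_a (H : FlipFrame Γ γ v a z) (hχ0 : χ 0 = 1) (k : Fin 6) :
    twist γ χ (z k) a = 1 + χ (orbitDiff k) := by
  have h1 := orbitDiff_ne_zero k
  have : ∀ i, χ i * adjInd γ (z k) a i =
      (if i = 0 then χ i else 0) + (if i = orbitDiff k then χ i else 0) := by
    intro i
    simp only [adjInd, H.adj_z]
    by_cases h2 : i = 0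
    · subst h2; simp [h1.symm]
    · simp [h2]
  rw [twist, Finset.sum_congr rfl fun i _ => this i, Finset.sum_add_distrib]
  simp [hχ0]

variable [Fintype V] [DecidableEq V]

theorem twist_a_a (H : FlipFrame Γ γ v a z) (h : Γ.IsSRGWith 99 14 1 2) :
    twist γ χ a a = χ 7 := by
  simp [twist, adjInd, H.adj_a_iff h H.adj_a]

theorem twist_mul (H : FlipFrame Γ γ v a z) (h : Γ.IsSRGWith 99 14 1 2)
    (hχ : ∀ i j, χ (i + j) = χ i * χ j) {x y : V} (hx : ¬ Γ.Adj v x) :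
    twist γ χ x a * twist γ χ a y + ∑ l, twist γ χ x (z l) * twist γ χ (z l) y =
      12 * (∑ i, χ i * if x = γ i y then 1 else 0) + 2 * ∑ i, χ i - twist γ χ x y := by
  have h1 : ∀ i, χ i * (∑ w, (if Γ.Adj x w then (1 : ℤ) else 0) *
      (if Γ.Adj w (γ i y) then 1 else 0)) =
      χ i * (∑ m, adjInd γ x a m * adjInd γ a y (i - m)) +
        ∑ l, χ i * (∑ m, adjInd γ x (z l) m * adjInd γ (z l) y (i - m)) := by
    intro i
    rw [H.sum_eq h, if_neg fun hxv : Γ.Adj x v => hx hxv.symm, zero_mul, zero_add, mul_add, Finset.mul_sum]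
    simp only [H.adj_iff, adjInd, Finset.mul_sum]
  have h2 : ∑ i, χ i * (∑ w, (if Γ.Adj x w then (1 : ℤ) else 0) *
      (if Γ.Adj w (γ i y) then 1 else 0)) =
      twist γ χ x a * twist γ χ a y + ∑ l, twist γ χ x (z l) * twist γ χ (z l) y := by
    rw [Finset.sum_congr rfl fun i _ => h1 i, Finset.sum_add_distrib, Finset.sum_comm,
      sum_mul_conv χ _ _ hχ]
    simp only [sum_mul_conv χ _ _ hχ]
    rfl
  rw [← h2]
  simp only [h.sum_adj_mul_adj, mul_sub, mul_add, Finset.sum_sub_distrib, Finset.sum_add_distrib]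
  congr 1
  rw [Finset.mul_sum, Finset.mul_sum]
  congr 1 <;> refine Finset.sum_congr rfl fun i _ => by ring

theorem twist_z_mul (H : FlipFrame Γ γ v a z) (h : Γ.IsSRGWith 99 14 1 2)
    (hχ : ∀ i j, χ (i + j) = χ i * χ j) (hχ0 : χ 0 = 1) (hχn : ∀ i, χ (-i) = χ i)
    (j k : Fin 6) :
    (1 + χ (orbitDiff j)) * (1 + χ (orbitDiff k)) +
        ∑ l, twist γ χ (z j) (z l) * twist γ χ (z l) (z k) =
      (if j = k then 12 else 0) + 2 * ∑ i, χ i - twist γ χ (z j) (z k) := by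
  have h1 := H.twist_mul h hχ (y := z k) (H.not_adj_v h j)
  rw [H.twist_symm hχn a, H.twist_z_a hχ0, H.twist_z_a hχ0] at h1
  rw [h1]
  congr 2
  have : ∀ i, χ i * (if z j = γ i (z k) then 1 else 0) =
      if i = 0 then (if j = k then 1 else 0) else 0 := by
    intro i
    by_cases h2 : z j = γ i (z k)
    · obtain ⟨rfl, rfl⟩ := H.apply_z_eq h2
      simp [← h2, hχ0]
    · rw [if_neg h2, mul_zero]
      split_ifs with h3 h4
      · subst h3 h4
        exact absurd (H.zero _).symm h2
      · rfl
      · rfl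
  rw [Finset.sum_congr rfl fun i _ => this i]
  simp

theorem twist_a_mul (H : FlipFrame Γ γ v a z) (h : Γ.IsSRGWith 99 14 1 2)
    (hχ : ∀ i j, χ (i + j) = χ i * χ j) (hχ0 : χ 0 = 1) (j : Fin 6) :
    (1 + χ (orbitDiff j)) * χ 7 +
        ∑ l, twist γ χ (z j) (z l) * (1 + χ (orbitDiff l)) =
      2 * ∑ i, χ i - (1 + χ (orbitDiff j)) := by
  have h1 := H.twist_mul h hχ (y := a) (H.not_adj_v h j)
  rw [H.twist_z_a hχ0, H.twist_a_a h] at h1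
  simp only [H.twist_z_a hχ0] at h1
  rw [h1]
  have : ∀ i, χ i * (if z j = γ i a then 1 else 0) = 0 := by
    intro i
    rw [if_neg, mul_zero]
    intro h2
    apply H.not_adj_v h j
    rw [h2, H.adj_v]
    exact H.adj_a
  rw [Finset.sum_congr rfl fun i _ => this i]
  simp

end FlipFrame

end OrderFourteen

end SimpleGraph

/-! ### The integer equations for the orbit matrices are inconsistent -/

theorem Int.even_of_sum_three_sq {a b c : ℤ} (h : 4 ∣ a ^ 2 + b ^ 2 + c ^ 2) :
    2 ∣ a ∧ 2 ∣ b ∧ 2 ∣ c := by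
  have key : ∀ x : ℤ, (x % 2 = 0 ∧ x ^ 2 % 4 = 0) ∨ (x % 2 = 1 ∧ x ^ 2 % 4 = 1) := by
    intro x
    rcases Int.even_or_odd' x with ⟨k, rfl | rfl⟩
    · left
      refine ⟨by omega, ?_⟩
      rw [show (2 * k) ^ 2 = 4 * k ^ 2 by ring]
      omega
    · right
      refine ⟨by omega, ?_⟩
      rw [show (2 * k + 1) ^ 2 = 4 * (k ^ 2 + k) + 1 by ring]
      omega
  have h1 := key a
  have h2 := key b
  have h3 := key c
  omega

theorem Int.eq_of_sum_three_sq_eq_one {a b c : ℤ} (h : a ^ 2 + b ^ 2 + c ^ 2 = 1) :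
    ((a = 1 ∨ a = -1) ∧ b = 0 ∧ c = 0) ∨ (a = 0 ∧ (b = 1 ∨ b = -1) ∧ c = 0) ∨
      (a = 0 ∧ b = 0 ∧ (c = 1 ∨ c = -1)) := by
  have key : ∀ x : ℤ, x = 0 ∨ 1 ≤ x ^ 2 := fun x => by
    rcases eq_or_ne x 0 with hx | hx
    · exact Or.inl hx
    · exact Or.inr (by have := sq_pos_of_ne_zero hx; omega)
  have key' : ∀ x : ℤ, x ^ 2 = 1 → x = 1 ∨ x = -1 := fun x hx => by
    have h1 : (x - 1) * (x + 1) = 0 := by linear_combination hx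
    rcases mul_eq_zero.1 h1 with h2 | h2 <;> omega
  have ha := sq_nonneg a
  have hb := sq_nonneg b
  have hc := sq_nonneg c
  rcases key a with rfl | ha1
  · rcases key b with rfl | hb1
    · exact Or.inr (Or.inr ⟨rfl, rfl, key' c (by linarith)⟩)
    · have hc0 : c = 0 := by
        rcases key c with h0 | h0
        · exact h0
        · omega
      subst hc0
      exact Or.inr (Or.inl ⟨rfl, key' b (by linarith), rfl⟩)
  · have hb0 : b = 0 := by
      rcases key b with h0 | h0
      · exact h0
      · omega
    have hc0 : c = 0 := by
      rcases key c with h0 | h0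
      · exact h0
      · omega
    subst hb0 hc0
    exact Or.inl ⟨key' a (by linarith), rfl, rfl⟩

namespace SimpleGraph

/-- The numerical properties of the orbit matrices of a `FlipAction`: `r` is the quotient matrix on
the six orbits at distance two, and `s` its twist by the sign character. -/
structure OrbitMatrices (r s : Fin 6 → Fin 6 → ℤ) : Prop where
  sum_r : ∀ j, ∑ l, r j l = 12
  sum_r_sq : ∀ j, ∑ l, r j l ^ 2 = 36 - r j j
  parity : ∀ j k, 2 ∣ r j k - s j k
  diag : ∀ j, (s j j = 0 ∧ r j j = 0) ∨ (s j j = -2 ∧ r j j = 2)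
  symm : ∀ j k, s j k = s k j
  sum_s : ∀ j, s j 0 + s j 1 + s j 2 = 0
  mul_s : ∀ j k, (if j < 3 then 2 else 0) * (if k < 3 then 2 else 0) + ∑ l, s j l * s l k =
    (if j = k then 12 else 0) - s j k

namespace OrbitMatrices

variable {r s : Fin 6 → Fin 6 → ℤ}

/-- By parity the row of `r` would be even, say 2m. Then Σ m = 6, and 4 Σ m² is 36 or 34, so Σ m² =
9; but m² and m have the same parity. -/
theorem not_all_even (H : OrbitMatrices r s) (j : Fin 6) (hj : ∀ k, 2 ∣ s j k) : False := by
  have h1 : ∀ k, ∃ m, r j k = 2 * m := by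
    intro k
    obtain ⟨a, ha⟩ := hj k
    obtain ⟨b, hb⟩ := H.parity j k
    exact ⟨a + b, by omega⟩
  choose m hm using h1
  have h2 := H.sum_r j
  have h3 := H.sum_r_sq j
  have h4 : r j j = 0 ∨ r j j = 2 := by
    rcases H.diag j with h | h
    · exact Or.inl h.2
    · exact Or.inr h.2
  have h5 : ∀ x : ℤ, 2 ∣ x ^ 2 - x := by
    intro x
    rw [show x ^ 2 - x = (x - 1) * (x - 1 + 1) by ring]
    exact (Int.even_mul_succ_self _).two_dvd
  have h6 : 2 ∣ ∑ l, (m l ^ 2 - m l) := Finset.dvd_sum fun l _ => h5 (m l)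
  simp only [hm, ← Finset.mul_sum, mul_pow, Finset.sum_sub_distrib] at h2 h3 h4 h6
  omega

/-- A row that vanishes on the first three columns is impossible. -/
theorem not_zero_row (H : OrbitMatrices r s) (j : Fin 6) (hj : j < 3) (h0 : s j 0 = 0)
    (h1 : s j 1 = 0) (h2 : s j 2 = 0) : False := by
  have hs : s j j = 0 := by
    have hlt : ∀ j : Fin 6, j < 3 → j = 0 ∨ j = 1 ∨ j = 2 := by decide
    rcases hlt j hj with rfl | rfl | rfl <;> assumption
  have h3 := H.mul_s j j
  rw [if_pos hj, if_pos rfl, Fin.sum_univ_six, H.symm 0 j, H.symm 1 j, H.symm 2 j,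
    H.symm 3 j, H.symm 4 j, H.symm 5 j, h0, h1, h2, hs] at h3
  have h4 := Int.even_of_sum_three_sq (a := s j 3) (b := s j 4) (c := s j 5)
    ⟨2, by linear_combination h3⟩
  apply H.not_all_even j
  intro k
  fin_cases k
  · exact ⟨0, by simpa using h0⟩
  · exact ⟨0, by simpa using h1⟩
  · exact ⟨0, by simpa using h2⟩
  · exact h4.1
  · exact h4.2.1
  · exact h4.2.2

/-- The case of exactly one nonzero diagonal entry in the first block. -/
theorem not_single (H : OrbitMatrices r s) {p q t : Fin 6} (hp : p < 3) (hq : q < 3) (ht : t < 3)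
    (hpq : p ≠ q) (hpt : p ≠ t)
    (hsum : ∀ f : Fin 6 → ℤ, ∑ l, f l = f p + f q + f t + (f 3 + f 4 + f 5))
    (hpp : s p p = -2) (hpq1 : s p q = 1) (hpt1 : s p t = 1) (hqq : s q q = 0) (htt : s t t = 0)
    (hqt : s q t = -1) : False := by
  have e1 := H.mul_s p p
  have e2 := H.mul_s p q
  have e3 := H.mul_s p t
  have f3 := H.mul_s p 3
  have f4 := H.mul_s p 4
  have f5 := H.mul_s p 5
  have d3 := H.diag 3
  have d4 := H.diag 4
  have d5 := H.diag 5
  rw [if_pos hp, if_pos rfl, hsum, H.symm q p, H.symm t p, H.symm 3 p, H.symm 4 p,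
    H.symm 5 p, hpp, hpq1, hpt1] at e1
  rw [if_pos hp, if_pos hq, if_neg hpq, hsum, H.symm t q, H.symm 3 q, H.symm 4 q,
    H.symm 5 q, hpp, hpq1, hpt1, hqq, hqt] at e2
  rw [if_pos hp, if_pos ht, if_neg hpt, hsum, H.symm 3 t, H.symm 4 t,
    H.symm 5 t, hpp, hpq1, hpt1, htt, hqt] at e3
  have n3 : p ≠ 3 := by rintro rfl; exact absurd hp (by decide)
  have n4 : p ≠ 4 := by rintro rfl; exact absurd hp (by decide)
  have n5 : p ≠ 5 := by rintro rfl; exact absurd hp (by decide)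
  rw [if_neg (show ¬ (3 : Fin 6) < 3 by decide), if_neg n3, hsum, hpp, hpq1, hpt1] at f3
  rw [if_neg (show ¬ (4 : Fin 6) < 3 by decide), if_neg n4, hsum, hpp, hpq1, hpt1] at f4
  rw [if_neg (show ¬ (5 : Fin 6) < 3 by decide), if_neg n5, hsum, hpp, hpq1, hpt1] at f5
  obtain ⟨⟨a, ha⟩, ⟨b, hb⟩, ⟨c, hc⟩⟩ :=
    Int.even_of_sum_three_sq (a := s p 3) (b := s p 4) (c := s p 5)
      ⟨1, by linear_combination e1⟩
  rw [ha, hb, hc] at e1 e2 e3 f3 f4 f5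
  have habc : a ^ 2 + b ^ 2 + c ^ 2 = 1 := by linarith
  clear ha hb hc e1
  -- Row `p` has a single entry 2ε in the last three columns, say in column k. The products with
  -- rows `q` and `t` give entries -ε there, and column k then demands `s k k = 2`, while diagonal
  -- entries are 0 or -2.
  rcases Int.eq_of_sum_three_sq_eq_one habc with ⟨rfl | rfl, rfl, rfl⟩ | ⟨rfl, rfl | rfl, rfl⟩ |
    ⟨rfl, rfl, rfl | rfl⟩
  · omega
  · omega
  · omega
  · omega
  · omega
  · omega

/-- The leading 3 × 3 block is symmetric with zero row sums, so its diagonal, with entries 0 or -2,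
determines it. No or two entries -2 produce a zero row, one is `not_single`, and three contradict
divisibility by 4. -/
theorem false (H : OrbitMatrices r s) : False := by
  have g0 := H.sum_s 0
  have g1 := H.sum_s 1
  have g2 := H.sum_s 2
  rw [H.symm 1 0] at g1
  rw [H.symm 2 0, H.symm 2 1] at g2
  have d0 : s 0 0 = 0 ∨ s 0 0 = -2 := (H.diag 0).imp And.left And.left
  have d1 : s 1 1 = 0 ∨ s 1 1 = -2 := (H.diag 1).imp And.left And.left
  have d2 : s 2 2 = 0 ∨ s 2 2 = -2 := (H.diag 2).imp And.left And.left
  have s10 := H.symm 1 0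
  have s20 := H.symm 2 0
  have s21 := H.symm 2 1
  rcases d0 with d0 | d0 <;> rcases d1 with d1 | d1 <;> rcases d2 with d2 | d2
  · exact H.not_zero_row 0 (by decide) (by omega) (by omega) (by omega)
  · exact H.not_single (p := 2) (q := 0) (t := 1) (by decide) (by decide) (by decide) (by decide)
      (by decide) (fun f => by rw [Fin.sum_univ_six]; ring) (by omega) (by omega) (by omega)
      (by omega) (by omega) (by omega)
  · exact H.not_single (p := 1) (q := 0) (t := 2) (by decide) (by decide) (by decide) (by decide)
      (by decide) (fun f => by rw [Fin.sum_univ_six]; ring) (by omega) (by omega) (by omega)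
      (by omega) (by omega) (by omega)
  · exact H.not_zero_row 0 (by decide) (by omega) (by omega) (by omega)
  · exact H.not_single (p := 0) (q := 1) (t := 2) (by decide) (by decide) (by decide) (by decide)
      (by decide) (fun f => by rw [Fin.sum_univ_six]; ring) (by omega) (by omega) (by omega)
      (by omega) (by omega) (by omega)
  · exact H.not_zero_row 1 (by decide) (by omega) (by omega) (by omega)
  · exact H.not_zero_row 2 (by decide) (by omega) (by omega) (by omega)
  · have h01 : s 0 1 = 1 := by omega
    have h02 : s 0 2 = 1 := by omega
    have h12 : s 1 2 = 1 := by omega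
    have e0 := H.mul_s 0 0
    have e1 := H.mul_s 1 1
    have e2 := H.mul_s 0 1
    rw [if_pos (by decide), if_pos rfl, Fin.sum_univ_six, s10, s20, H.symm 3 0, H.symm 4 0, H.symm 5 0, d0, h01, h02] at e0
    rw [if_pos (by decide), if_pos rfl, Fin.sum_univ_six, s10, s21, H.symm 3 1, H.symm 4 1, H.symm 5 1, d1, h01, h12] at e1
    rw [if_pos (by decide), if_pos (by decide), if_neg (by decide), Fin.sum_univ_six, s21, H.symm 3 1, H.symm 4 1, H.symm 5 1, d0, d1, h01, h02, h12] at e2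
    obtain ⟨⟨a, ha⟩, ⟨b, hb⟩, ⟨c, hc⟩⟩ :=
      Int.even_of_sum_three_sq (a := s 0 3) (b := s 0 4) (c := s 0 5)
        ⟨1, by linear_combination e0⟩
    obtain ⟨⟨a', ha'⟩, ⟨b', hb'⟩, ⟨c', hc'⟩⟩ :=
      Int.even_of_sum_three_sq (a := s 1 3) (b := s 1 4) (c := s 1 5)
        ⟨1, by linear_combination e1⟩
    rw [ha, hb, hc, ha', hb', hc'] at e2
    -- Rows 0 and 1 are even in the last three columns, so their inner product there is a multiple
    -- of 4, yet it must be -2.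
    have h4 : 4 * (a * a' + b * b' + c * c') = -2 := by linear_combination e2
    omega

end OrbitMatrices

end SimpleGraph

/-! ### Orbit matrices of an actual automorphism of order 14 -/

theorem ZMod.sum_univ_fourteen (f : ZMod 14 → ℤ) :
    ∑ i, f i = f 0 + f 1 + f 2 + f 3 + f 4 + f 5 + f 6 + f 7 + f 8 + f 9 + f 10 + f 11 + f 12 +
      f 13 := by
  have : (Finset.univ : Finset (ZMod 14)) = {0, 1, 2, 3, 4, 5, 6, 7, 8, 9, 10, 11, 12, 13} := by
    decide
  rw [this]
  repeat rw [Finset.sum_insert (by decide)]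
  rw [Finset.sum_singleton]
  ring

/-- The sign character of `ZMod 14`. -/
def ZMod.sgn (i : ZMod 14) : ℤ := if i.val % 2 = 0 then 1 else -1

theorem ZMod.sgn_add : ∀ i j, ZMod.sgn (i + j) = ZMod.sgn i * ZMod.sgn j := by decide

theorem ZMod.sgn_neg : ∀ i, ZMod.sgn (-i) = ZMod.sgn i := by decide

theorem ZMod.two_dvd_one_sub_sgn : ∀ i, 2 ∣ 1 - ZMod.sgn i := by decide

namespace SimpleGraph

section OrderFourteen

variable {V : Type*} {Γ : SimpleGraph V} {γ : ZMod 14 → Γ ≃g Γ} {v a : V} {z : Fin 6 → V}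

theorem FlipAction.pow_eq (H : FlipAction Γ γ v) (i : ZMod 14) (n : ℕ) :
    γ i ^ n = γ (n * i) := by
  induction n with
  | zero => ext x; change x = _; rw [Nat.cast_zero, zero_mul, H.zero]
  | succ k ih =>
    ext x
    rw [pow_succ', ih]
    change γ i (γ (k * i) x) = _
    rw [← H.add]
    congr 2
    push_cast
    ring

theorem FlipFrame.adj_neg (H : FlipFrame Γ γ v a z) {x : V} (i j : ZMod 14) (hij : i + j = 0)
    (h : Γ.Adj x (γ i x)) : Γ.Adj x (γ j x) := by
  obtain rfl : j = -i := by linear_combination hij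
  rw [← (γ (-i)).map_rel_iff, H.neg_apply] at h
  exact h.symm

section

variable [DecidableRel Γ.Adj]

theorem adjInd_zero_or_one (x y : V) (i : ZMod 14) :
    adjInd γ x y i = 0 ∨ adjInd γ x y i = 1 := by
  rw [adjInd]; split_ifs <;> simp

theorem adj_of_adjInd {x y : V} {i : ZMod 14} (h : adjInd γ x y i = 1) : Γ.Adj x (γ i y) := by
  by_contra h1
  rw [adjInd, if_neg h1] at h
  exact zero_ne_one h

end

variable [Fintype V] [DecidableEq V]

theorem FlipAction.fixedCount_eq (H : FlipAction Γ γ v) {i : ZMod 14} (hi : i ≠ 0) :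
    fixedCount (γ i) = 1 := by
  rw [fixedCount, Finset.card_eq_one]
  refine ⟨v, ?_⟩
  ext x
  simp only [Finset.mem_filter, Finset.mem_univ, true_and, Finset.mem_singleton]
  constructor
  · intro hx
    exact (H.free i x hx).resolve_left hi
  · rintro rfl
    exact H.fix i

variable [DecidableRel Γ.Adj]

namespace FlipFrame

theorem shiftCount_eq (H : FlipFrame Γ γ v a z) (h : Γ.IsSRGWith 99 14 1 2) {i : ZMod 14}
    (hi : i ≠ 7) : (shiftCount (γ i) : ℤ) = 14 * ∑ l, adjInd γ (z l) (z l) i := by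
  have h1 : (shiftCount (γ i) : ℤ) = ∑ x, if Γ.Adj x (γ i x) then 1 else 0 := by
    rw [Finset.sum_boole]; rfl
  have h2 : ∀ m x, Γ.Adj (γ m x) (γ i (γ m x)) ↔ Γ.Adj x (γ i x) := by
    intro m x
    rw [← H.add, H.adj_iff, add_sub_cancel_right]
  rw [h1, H.sum_eq h]
  simp only [h2, H.fix, H.adj_a_iff h H.adj_a, if_neg hi, Finset.sum_const, Γ.irrefl, if_false,
    Finset.card_univ, ZMod.card, nsmul_eq_mul, mul_zero, zero_add, Finset.mul_sum]
  rfl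

/-- Two orbit elements have at most two common neighbours in an orbit. -/
theorem not_three (H : FlipFrame Γ γ v a z) (h : Γ.IsSRGWith 99 14 1 2) (j : Fin 6)
    {i m₁ m₂ m₃ : ZMod 14} (hi : i ≠ 0) (h12 : m₁ ≠ m₂) (h13 : m₁ ≠ m₃) (h23 : m₂ ≠ m₃)
    (h1 : Γ.Adj (z j) (γ m₁ (z j))) (h2 : Γ.Adj (z j) (γ m₂ (z j)))
    (h3 : Γ.Adj (z j) (γ m₃ (z j))) (h1' : Γ.Adj (z j) (γ (m₁ - i) (z j)))
    (h2' : Γ.Adj (z j) (γ (m₂ - i) (z j))) (h3' : Γ.Adj (z j) (γ (m₃ - i) (z j))) : False := by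
  have hcard := h.card_common (z j) (γ i (z j))
  have hne : z j ≠ γ i (z j) := fun h4 => hi (H.apply_z_eq h4).2
  rw [if_neg hne] at hcard
  have hsub : ({γ m₁ (z j), γ m₂ (z j), γ m₃ (z j)} : Finset V) ⊆
      Finset.univ.filter fun w => Γ.Adj (z j) w ∧ Γ.Adj (γ i (z j)) w := by
    intro w hw
    simp only [Finset.mem_insert, Finset.mem_singleton] at hw
    simp only [Finset.mem_filter, Finset.mem_univ, true_and]
    rcases hw with rfl | rfl | rfl
    · exact ⟨h1, by rwa [H.adj_iff]⟩
    · exact ⟨h2, by rwa [H.adj_iff]⟩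
    · exact ⟨h3, by rwa [H.adj_iff]⟩
  have hle := Finset.card_le_card hsub
  rw [Finset.card_eq_three.2 ⟨_, _, _, fun h4 => h12 (H.eq_of_apply_eq (H.ne_v j) h4),
    fun h4 => h13 (H.eq_of_apply_eq (H.ne_v j) h4),
    fun h4 => h23 (H.eq_of_apply_eq (H.ne_v j) h4), rfl⟩] at hle
  split_ifs at hcard <;> omega

/-- An orbit contains at most one pair of differences of given parity. -/
theorem adjInd_add_le (H : FlipFrame Γ γ v a z) (h : Γ.IsSRGWith 99 14 1 2) (j : Fin 6) :
    adjInd γ (z j) (z j) 2 + adjInd γ (z j) (z j) 4 + adjInd γ (z j) (z j) 6 ≤ 1 ∧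
    adjInd γ (z j) (z j) 1 + adjInd γ (z j) (z j) 3 + adjInd γ (z j) (z j) 5 ≤ 1 := by
  have key : ∀ i m₁ m₂ m₃ : ZMod 14, ∀ p q : ZMod 14, i ≠ 0 → m₁ ≠ m₂ → m₁ ≠ m₃ → m₂ ≠ m₃ →
      (∀ m ∈ ({m₁, m₂, m₃, m₁ - i, m₂ - i, m₃ - i} : Finset (ZMod 14)),
        m = p ∨ m + p = 0 ∨ m = q ∨ m + q = 0) →
      adjInd γ (z j) (z j) p = 1 → adjInd γ (z j) (z j) q = 1 → False := by
    intro i m₁ m₂ m₃ p q hi h12 h13 h23 hm hp hq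
    have hadj : ∀ m ∈ ({m₁, m₂, m₃, m₁ - i, m₂ - i, m₃ - i} : Finset (ZMod 14)),
        Γ.Adj (z j) (γ m (z j)) := by
      intro m hm'
      rcases hm m hm' with rfl | h1 | rfl | h1
      · exact adj_of_adjInd hp
      · exact H.adj_neg p m (by rw [add_comm]; exact h1) (adj_of_adjInd hp)
      · exact adj_of_adjInd hq
      · exact H.adj_neg q m (by rw [add_comm]; exact h1) (adj_of_adjInd hq)
    exact H.not_three h j hi h12 h13 h23 (hadj _ (by simp)) (hadj _ (by simp)) (hadj _ (by simp))
      (hadj _ (by simp)) (hadj _ (by simp)) (hadj _ (by simp))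
  -- If `z j` is adjacent to its translates by ±2 and ±4, it shares the translates by 2, 4 and 10
  -- with its translate by 6, one common neighbour too many. The other five pairs are alike.
  have k24 := key 6 2 4 10 2 4 (by decide) (by decide) (by decide) (by decide) (by decide)
  have k26 := key 4 2 6 12 2 6 (by decide) (by decide) (by decide) (by decide) (by decide)
  have k46 := key 12 6 4 8 4 6 (by decide) (by decide) (by decide) (by decide) (by decide)
  have k13 := key 2 1 3 13 1 3 (by decide) (by decide) (by decide) (by decide) (by decide)
  have k15 := key 10 5 9 1 1 5 (by decide) (by decide) (by decide) (by decide) (by decide)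
  have k35 := key 6 3 11 9 3 5 (by decide) (by decide) (by decide) (by decide) (by decide)
  have e := fun i => adjInd_zero_or_one (γ := γ) (z j) (z j) i
  have e1 := e 1
  have e2 := e 2
  have e3 := e 3
  have e4 := e 4
  have e5 := e 5
  have e6 := e 6
  constructor
  · rcases e2 with e2 | e2 <;> rcases e4 with e4 | e4 <;> rcases e6 with e6 | e6 <;>
      first
      | (rw [e2, e4, e6]; norm_num; done)
      | exact (k24 e2 e4).elim
      | exact (k26 e2 e6).elim
      | exact (k46 e4 e6).elim
  · rcases e1 with e1 | e1 <;> rcases e3 with e3 | e3 <;> rcases e5 with e5 | e5 <;>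
      first
      | (rw [e1, e3, e5]; norm_num; done)
      | exact (k13 e1 e3).elim
      | exact (k15 e1 e5).elim
      | exact (k35 e3 e5).elim

/-- By integrality of multiplicities, no orbit contains an even difference. -/
theorem adjInd_even (H : FlipFrame Γ γ v a z) (h : Γ.IsSRGWith 99 14 1 2) (j : Fin 6) :
    adjInd γ (z j) (z j) 2 + adjInd γ (z j) (z j) 4 + adjInd γ (z j) (z j) 6 = 0 := by
  have hpow : (γ 2) ^ 7 = 1 := by
    rw [H.pow_eq]
    ext x
    change γ 0 x = x
    exact H.zero x
  have htr := h.dvd_sum_trace (γ 2) (n := 7) (by norm_num) hpow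
  have hneg : ∀ i k l, i + k = 0 → adjInd γ (z l) (z l) k = adjInd γ (z l) (z l) i := by
    intro i k l hik
    obtain rfl : i = -k := by linear_combination hik
    exact H.adjInd_symm _ _ _
  have hterm : ∀ n : ℕ, ∀ i : ZMod 14, (n : ZMod 14) * 2 = i → i ≠ 0 → i ≠ 7 →
      (shiftCount (γ 2 ^ n) : ℤ) + 4 * fixedCount (γ 2 ^ n) - 18 =
        14 * ∑ l, adjInd γ (z l) (z l) i - 14 := by
    intro n i hni h0 h7
    rw [H.pow_eq, hni, H.shiftCount_eq h h7, H.fixedCount_eq h0]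
    ring
  set T := ∑ l, (adjInd γ (z l) (z l) 2 + adjInd γ (z l) (z l) 4 + adjInd γ (z l) (z l) 6) with hT
  have hnn : ∀ l, 0 ≤ adjInd γ (z l) (z l) 2 + adjInd γ (z l) (z l) 4 + adjInd γ (z l) (z l) 6 := by
    intro l
    have e := fun i => adjInd_zero_or_one (γ := γ) (z l) (z l) i
    have e2 := e 2
    have e4 := e 4
    have e6 := e 6
    omega
  have hT0 : 0 ≤ T := Finset.sum_nonneg fun l _ => hnn l
  have hT6 : T ≤ 6 := by
    have := Finset.sum_le_card_nsmul Finset.univ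
      (fun l => adjInd γ (z l) (z l) 2 + adjInd γ (z l) (z l) 4 + adjInd γ (z l) (z l) 6) 1
      fun l _ => (H.adjInd_add_le h l).1
    simpa using this
  rw [Finset.sum_range_succ, Finset.sum_range_succ, Finset.sum_range_succ, Finset.sum_range_succ,
    Finset.sum_range_succ, Finset.sum_range_succ, Finset.sum_range_one, pow_zero, shiftCount_one,
    h.fixedCount_one, hterm 1 2 (by decide) (by decide) (by decide),
    hterm 2 4 (by decide) (by decide) (by decide), hterm 3 6 (by decide) (by decide) (by decide),
    hterm 4 8 (by decide) (by decide) (by decide), hterm 5 10 (by decide) (by decide) (by decide),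
    hterm 6 12 (by decide) (by decide) (by decide)] at htr
  simp only [hneg 6 8 _ (by decide), hneg 4 10 _ (by decide), hneg 2 12 _ (by decide)] at htr
  have hTT : T = ∑ l, adjInd γ (z l) (z l) 2 + ∑ l, adjInd γ (z l) (z l) 4 +
      ∑ l, adjInd γ (z l) (z l) 6 := by
    rw [hT, Finset.sum_add_distrib, Finset.sum_add_distrib]
  -- The trace sum is 378 + 28T - 84 = 294 + 28T. Divisibility by 49 gives 7 ∣ T, and T is at most
  -- 6.
  have hTz : T = 0 := by
    push_cast at htr
    omega
  exact (Finset.sum_eq_zero_iff_of_nonneg fun l _ => hnn l).1 hTz j (Finset.mem_univ j)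

/-- The rows for `r` come from the trivial character, those for `s` from the sign. On the diagonal,
differences 0, 7 and all even ones are absent, and at most one pair of opposite odd differences
occurs, adding 2 to `r` and -2 to `s`. -/
theorem orbitMatrices (H : FlipFrame Γ γ v a z) (h : Γ.IsSRGWith 99 14 1 2) :
    OrbitMatrices (fun j k => twist γ 1 (z j) (z k))
      (fun j k => twist γ ZMod.sgn (z j) (z k)) where
  sum_r j := by
    have h1 := H.twist_a_mul h (χ := 1) (by simp) rfl j
    simp only [Pi.one_apply, ← Finset.sum_mul, Finset.sum_const, Finset.card_univ,
      ZMod.card] at h1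
    norm_num at h1
    linarith
  sum_r_sq j := by
    have h1 := H.twist_z_mul h (χ := 1) (by simp) rfl (by simp) j j
    simp only [Pi.one_apply, Finset.sum_const, Finset.card_univ, ZMod.card, if_true] at h1
    norm_num at h1
    have h2 : ∀ l, twist γ 1 (z j) (z l) ^ 2 = twist γ 1 (z j) (z l) * twist γ 1 (z l) (z j) := by
      intro l
      rw [H.twist_symm (χ := 1) (by simp) (z l) (z j), sq]
    simp only [h2]
    linarith
  parity j k := by
    simp only [twist]
    rw [← Finset.sum_sub_distrib]
    refine Finset.dvd_sum fun i _ => ?_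
    rw [← sub_mul]
    exact Dvd.dvd.mul_right (ZMod.two_dvd_one_sub_sgn i) _
  diag j := by
    have hneg : ∀ i k, i + k = 0 → adjInd γ (z j) (z j) k = adjInd γ (z j) (z j) i := by
      intro i k hik
      obtain rfl : i = -k := by linear_combination hik
      exact H.adjInd_symm _ _ _
    have e := fun i => adjInd_zero_or_one (γ := γ) (z j) (z j) i
    have h0 : adjInd γ (z j) (z j) 0 = 0 := by
      rw [adjInd, H.zero, if_neg (Γ.irrefl)]
    have h7 : adjInd γ (z j) (z j) 7 = 0 := by
      rw [adjInd, if_neg]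
      rw [← H.flip]
      exact H.not_adj_v h j
    have hev := H.adjInd_even h j
    have hod := (H.adjInd_add_le h j).2
    have e1 := e 1
    have e2 := e 2
    have e3 := e 3
    have e4 := e 4
    have e5 := e 5
    have e6 := e 6
    simp only [twist, ZMod.sum_univ_fourteen, Pi.one_apply, one_mul, h0, h7,
      hneg 6 8 (by decide), hneg 5 9 (by decide), hneg 4 10 (by decide), hneg 3 11 (by decide),
      hneg 2 12 (by decide), hneg 1 13 (by decide)]
    have s1 : ZMod.sgn 1 = -1 := by decide
    have s2 : ZMod.sgn 2 = 1 := by decide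
    have s3 : ZMod.sgn 3 = -1 := by decide
    have s4 : ZMod.sgn 4 = 1 := by decide
    have s5 : ZMod.sgn 5 = -1 := by decide
    have s6 : ZMod.sgn 6 = 1 := by decide
    have s8 : ZMod.sgn 8 = 1 := by decide
    have s9 : ZMod.sgn 9 = -1 := by decide
    have s10 : ZMod.sgn 10 = 1 := by decide
    have s11 : ZMod.sgn 11 = -1 := by decide
    have s12 : ZMod.sgn 12 = 1 := by decide
    have s13 : ZMod.sgn 13 = -1 := by decide
    rw [s1, s2, s3, s4, s5, s6, s8, s9, s10, s11, s12, s13]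
    omega
  symm j k := H.twist_symm ZMod.sgn_neg _ _
  sum_s j := by
    have h1 := H.twist_a_mul h ZMod.sgn_add (by decide) j
    -- `orbitDiff` lists the even differences first, so the sign is 1 precisely on the first three
    -- orbits.
    have u : ∀ l, 1 + ZMod.sgn (orbitDiff l) = if l < 3 then 2 else 0 := by decide
    have s7 : ZMod.sgn 7 = -1 := by decide
    have hs : ∑ i, ZMod.sgn i = 0 := by decide
    rw [s7, hs, Fin.sum_univ_six] at h1
    simp only [u 0, u 1, u 2, u 3, u 4, u 5] at h1
    rw [if_pos (by decide), if_pos (by decide), if_pos (by decide), if_neg (by decide),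
      if_neg (by decide), if_neg (by decide)] at h1
    linarith
  mul_s j k := by
    have h1 := H.twist_z_mul h ZMod.sgn_add (by decide) ZMod.sgn_neg j k
    have u : ∀ l, 1 + ZMod.sgn (orbitDiff l) = if l < 3 then 2 else 0 := by decide
    have hs : ∑ i, ZMod.sgn i = 0 := by decide
    rw [u, u, hs, mul_zero, add_zero] at h1
    exact h1

end FlipFrame

/-- There is no automorphism of order `14` fixing a vertex. -/
theorem IsSRGWith.orderOf_ne_fourteen (h : Γ.IsSRGWith 99 14 1 2) {g : Γ ≃g Γ} (hv : g v = v) :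
    orderOf g ≠ 14 := by
  intro ho
  have hg : g ^ 14 = 1 := by rw [← ho]; exact pow_orderOf_eq_one g
  have hne : ∀ n, n % 14 ≠ 0 → g ^ n ≠ 1 := by
    intro n hn h1
    have := orderOf_dvd_of_pow_eq_one h1
    rw [ho] at this
    omega
  have hfix : ∀ n, (g ^ n) v = v := by
    intro n
    rw [← iterate_iso]
    exact Function.iterate_fixed hv n
  have hodd7 : ∀ n, n % 7 ≠ 0 → ∀ x, (g ^ n) x = x → x = v := by
    intro n hn x hx
    -- Doubling the exponent removes the 2-part, leaving an element of order 7 that still fixes `x`.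
    have h2 : (g ^ (2 * n)) x = x := by
      rw [two_mul, pow_add]
      change (g ^ n) ((g ^ n) x) = x
      rw [hx, hx]
    refine h.eq_of_fixed_of_pow_seven (g := g ^ (2 * n)) ?_ (hne _ (by omega)) h2 (hfix _)
    rw [← pow_mul, show 2 * n * 7 = 14 * n by ring, pow_mul, hg, one_pow]
  have hinv := h.involution_fixedCount (t := g ^ 7) (by rw [← pow_mul, hg]) (hne 7 (by norm_num))
  have h7 : ∀ x, (g ^ 7) x = x → x = v := by
    intro x hx
    have h1 := hinv.1
    rw [fixedCount, Finset.card_eq_one] at h1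
    obtain ⟨y, hy⟩ := h1
    have hx' : x ∈ Finset.univ.filter fun x => (g ^ 7) x = x := by simpa using hx
    have hv' : v ∈ Finset.univ.filter fun x => (g ^ 7) x = x := by simpa using hfix 7
    rw [hy, Finset.mem_singleton] at hx' hv'
    rw [hx', hv']
  have H : FlipAction Γ (fun i => g ^ i.val) v := by
    refine ⟨fun i j x => ?_, fun x => ?_, fun i => hfix _, fun i x hx => ?_, fun x => ?_⟩
    · change (g ^ (i + j).val) x = (g ^ i.val * g ^ j.val) x
      rw [← pow_add, ZMod.val_add, ← pow_eq_pow_mod _ hg]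
    · rfl
    · by_cases hi : i = 0
      · exact Or.inl hi
      · right
        have hval : ∀ i : ZMod 14, i ≠ 0 → i.val = 7 ∨ i.val % 7 ≠ 0 := by decide
        rcases hval i hi with h1 | h1
        · change (g ^ i.val) x = x at hx
          rw [h1] at hx
          exact h7 x hx
        · exact hodd7 _ h1 x hx
    · change _ ↔ Γ.Adj x ((g ^ 7) x)
      have hflip := hinv.2 v (hfix 7)
      constructor
      · intro hvx
        have hs : (Finset.univ.filter fun x => Γ.Adj v x ∧ Γ.Adj x ((g ^ 7) x)) ⊆
            Finset.univ.filter fun x => Γ.Adj v x := by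
          intro y hy
          simp only [Finset.mem_filter, Finset.mem_univ, true_and] at hy ⊢
          exact hy.1
        have heq := Finset.eq_of_subset_of_card_le hs (by rw [h.card_adj]; exact hflip.ge)
        have hx : x ∈ Finset.univ.filter fun x => Γ.Adj v x := by simpa using hvx
        rw [← heq] at hx
        simp only [Finset.mem_filter, Finset.mem_univ, true_and] at hx
        exact hx.2
      · intro hx
        -- The third vertex on the flipped edge is fixed by the involution, hence is `v`.
        obtain ⟨y, hy⟩ := h.exists_third hx
        have hy1 := (hy y).2 rfl
        have h77 : (g ^ 7) ((g ^ 7) x) = x := by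
          change (g ^ 7 * g ^ 7) x = x
          rw [← pow_add, hg]
          rfl
        have h8 := (g ^ 7).map_rel_iff.2 hy1.1
        have h9 := (g ^ 7).map_rel_iff.2 hy1.2
        rw [h77] at h9
        have := h7 y ((hy _).1 ⟨h9, h8⟩)
        rw [← this]
        exact hy1.1.symm
  obtain ⟨a, z, hF⟩ := H.exists_frame h
  exact (hF.orbitMatrices h).false

end OrderFourteen

end SimpleGraph

/-! ### Group-theoretic preliminaries -/

theorem exists_pow_orderOf_eq_prime_of_pow {G : Type*} [Group G] [Finite G] {x : G} {p k : ℕ}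
    (hp : p.Prime) (hx : x ^ p ^ k = 1) (hx1 : x ≠ 1) : ∃ m, orderOf (x ^ m) = p := by
  obtain ⟨j, -, hj⟩ := (Nat.dvd_prime_pow hp).1 (orderOf_dvd_of_pow_eq_one hx)
  cases j with
  | zero =>
    rw [pow_zero, orderOf_eq_one_iff] at hj
    exact absurd hj hx1
  | succ j =>
    refine ⟨p ^ j, ?_⟩
    rw [orderOf_pow, hj, pow_succ, Nat.gcd_mul_right_left,
      Nat.mul_div_cancel_left _ (pow_pos hp.pos j)]

/-- Order and index of a Sylow `p`-subgroup of a group of order `p * m` with `p` not dividing `m`. -/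
theorem Sylow.card_and_index_of_card_eq {G : Type*} [Group G] [Finite G] {p m : ℕ}
    [hp : Fact p.Prime] (hG : Nat.card G = p * m) (hm : ¬ p ∣ m) (P : Sylow p G) :
    Nat.card P = p ∧ (P : Subgroup G).index = m := by
  obtain ⟨k, hk⟩ := (IsPGroup.iff_card).1 P.2
  have hmul := (P : Subgroup G).card_mul_index
  have hnd := P.not_dvd_index
  rw [hk, hG] at hmul
  have hpos := hp.out.pos
  rcases k with _ | _ | k
  · rw [pow_zero, one_mul] at hmul
    exact absurd ⟨m, hmul⟩ hnd
  · rw [zero_add, pow_one] at hmul hk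
    exact ⟨hk, Nat.eq_of_mul_eq_mul_left hpos hmul⟩
  · rw [pow_succ', pow_succ', mul_assoc, mul_assoc] at hmul
    exact absurd ⟨_, (Nat.eq_of_mul_eq_mul_left hpos hmul).symm⟩ hm

/-- A Sylow subgroup of order `p` is normal if no nontrivial divisor of its index is `1` mod `p`. -/
theorem Sylow.normal_of_card_eq {G : Type*} [Group G] [Finite G] {p m : ℕ} [hp : Fact p.Prime]
    (hG : Nat.card G = p * m) (hm : ¬ p ∣ m) (h1 : ∀ d, d ∣ m → d % p = 1 → d = 1)
    (P : Sylow p G) : (P : Subgroup G).Normal := by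
  have hd := P.card_dvd_index
  rw [(P.card_and_index_of_card_eq hG hm).2] at hd
  have hmod := card_sylow_modEq_one p G
  rw [Nat.ModEq, Nat.mod_eq_of_lt hp.out.one_lt] at hmod
  have := (Nat.card_eq_one_iff_unique.1 (h1 _ hd hmod)).1
  exact P.normal_of_subsingleton

/-! ### The order of the automorphism group -/

namespace SimpleGraph

section Group

instance finite_iso {V : Type*} [Finite V] {Γ : SimpleGraph V} : Finite (Γ ≃g Γ) :=
  DFunLike.finite _

theorem pow_apply_of_fixed {V : Type*} {Γ : SimpleGraph V} {g : Γ ≃g Γ} {x : V} (hx : g x = x) (n : ℕ) : (g ^ n) x = x := by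
  rw [← iterate_iso]
  exact Function.iterate_fixed hx n

variable {V : Type*} [Fintype V] {Γ : SimpleGraph V} [DecidableRel Γ.Adj]

theorem IsSRGWith.exists_fixed_sylow (h : Γ.IsSRGWith 99 14 1 2) [Fact (Nat.Prime 7)]
    (P : Sylow 7 (Γ ≃g Γ)) : ∃ v : V, ∀ x ∈ P, x v = v := by
  have h1 := P.2.card_modEq_card_fixedPoints V
  rw [Nat.card_eq_fintype_card, h.card] at h1
  by_contra hcon
  push Not at hcon
  have : IsEmpty (MulAction.fixedPoints P V) := ⟨fun x => by
    obtain ⟨g, hg, hgx⟩ := hcon x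
    exact hgx (x.2 ⟨g, hg⟩)⟩
  rw [Nat.card_of_isEmpty] at h1
  exact absurd h1 (by decide)

variable [DecidableEq V]

theorem IsSRGWith.exists_adj (h : Γ.IsSRGWith 99 14 1 2) (v : V) : ∃ a, Γ.Adj v a := by
  obtain ⟨a, ha⟩ := Finset.card_pos.1 (by rw [h.card_adj v]; norm_num)
  exact ⟨a, by simpa using ha⟩

theorem IsSRGWith.eq_one_of_pow_seven_pow (h : Γ.IsSRGWith 99 14 1 2) {x : Γ ≃g Γ} {k : ℕ}
    (hx : x ^ 7 ^ k = 1) {u w : V} (hu : x u = u) (hw : x w = w) (huw : u ≠ w) : x = 1 := by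
  by_contra hx1
  obtain ⟨m, hm⟩ := exists_pow_orderOf_eq_prime_of_pow (by norm_num) hx hx1
  refine huw (h.eq_of_fixed_of_pow_seven (g := x ^ m) ?_ ?_ (pow_apply_of_fixed hu m)
    (pow_apply_of_fixed hw m))
  · rw [← hm]; exact pow_orderOf_eq_one _
  · intro h1
    rw [h1, orderOf_one] at hm
    norm_num at hm

/-- The Sylow `7`-subgroup has order `7`. -/
theorem IsSRGWith.card_sylow_seven (h : Γ.IsSRGWith 99 14 1 2) [Fact (Nat.Prime 7)]
    (h7 : 7 ∣ Nat.card (Γ ≃g Γ)) (P : Sylow 7 (Γ ≃g Γ)) : Nat.card P = 7 := by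
  obtain ⟨v, hv⟩ := h.exists_fixed_sylow P
  obtain ⟨a, ha⟩ := h.exists_adj v
  obtain ⟨k, hk⟩ := (IsPGroup.iff_card).1 P.2
  have hle : Nat.card P ≤ 14 := by
    have hcard : Nat.card {x // Γ.Adj v x} = 14 := by
      rw [Nat.card_eq_fintype_card, Fintype.card_subtype, h.card_adj]
    rw [← hcard]
    -- Evaluation at the neighbour `a` of `v` is injective, because a 7-element fixing both `v` and
    -- `a` is trivial.
    refine Nat.card_le_card_of_injective (fun x : P => ⟨x.1 a, ?_⟩) ?_
    · have := x.1.map_rel_iff.2 ha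
      rwa [hv _ x.2] at this
    · intro x y hxy
      have hxy' : x.1 a = y.1 a := congrArg Subtype.val hxy
      have hz : (y⁻¹ * x) = 1 := by
        apply Subtype.ext
        refine h.eq_one_of_pow_seven_pow (k := k) ?_ (hv _ (y⁻¹ * x).2) ?_ ha.ne
        · rw [← Subgroup.coe_pow, ← hk, pow_card_eq_one']
          rfl
        · change y.1⁻¹ (x.1 a) = a
          rw [hxy', RelIso.inv_apply_self]
      exact (inv_mul_eq_one.1 hz).symm
  have hdvd : 7 ∣ Nat.card P := P.dvd_card_of_dvd_card h7
  rw [hk] at hle hdvd ⊢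
  rcases k with _ | _ | k
  · norm_num at hdvd
  · norm_num
  · rw [pow_succ, pow_succ] at hle
    have := Nat.one_le_pow k 7 (by norm_num)
    omega

/-- An involution fixing `v` exchanges the two ends of every edge in the neighbourhood of `v`. -/
theorem IsSRGWith.involution_apply (h : Γ.IsSRGWith 99 14 1 2) {t : Γ ≃g Γ} (ht2 : t ^ 2 = 1)
    (ht1 : t ≠ 1) {v x : V} (hv : t v = v) (hx : Γ.Adj v x) : t x = Γ.third v x := by
  have hflip := (h.involution_fixedCount ht2 ht1).2 v hv
  have hs : (Finset.univ.filter fun x => Γ.Adj v x ∧ Γ.Adj x (t x)) ⊆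
      Finset.univ.filter fun x => Γ.Adj v x := by
    intro y hy
    simp only [Finset.mem_filter, Finset.mem_univ, true_and] at hy ⊢
    exact hy.1
  have heq := Finset.eq_of_subset_of_card_le hs (by rw [h.card_adj]; exact hflip.ge)
  have hx' : x ∈ Finset.univ.filter fun x => Γ.Adj v x := by simpa using hx
  rw [← heq] at hx'
  simp only [Finset.mem_filter, Finset.mem_univ, true_and] at hx'
  have h1 := t.map_rel_iff.2 hx
  rw [hv] at h1
  exact (h.third_eq hx h1 hx'.2).symm

/-- An involution and an element of order `7` cannot fix the same vertex. -/
theorem IsSRGWith.not_involution_fixed (h : Γ.IsSRGWith 99 14 1 2) {t p : Γ ≃g Γ}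
    (ht : orderOf t = 2) (hp : orderOf p = 7) {v : V} (htv : t v = v) (hpv : p v = v) : False := by
  have ht2 : t ^ 2 = 1 := by rw [← ht]; exact pow_orderOf_eq_one t
  have ht1 : t ≠ 1 := by
    rintro rfl
    rw [orderOf_one] at ht
    norm_num at ht
  have hinv : ∀ (g : Γ ≃g Γ) (x y : V), g x = y → g⁻¹ y = x := by
    rintro g x y rfl
    exact RelIso.inv_apply_self g x
  -- Near `v` the involution is the triangle pairing, which `p` preserves, so both composites agree
  -- on `v` and its neighbours.
  have hcomm : (t * p)⁻¹ * (p * t) = 1 := by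
    apply h.eq_one_of_fix_neighbors (v := v)
    · refine hinv (t * p) v ((p * t) v) ?_
      change t (p v) = p (t v)
      rw [hpv, htv, hpv]
    · intro x hx
      refine hinv (t * p) x ((p * t) x) ?_
      change t (p x) = p (t x)
      have hpx := p.map_rel_iff.2 hx
      rw [hpv] at hpx
      rw [h.involution_apply ht2 ht1 htv hpx, h.involution_apply ht2 ht1 htv hx,
        h.map_third p hx, hpv]
  have hc : Commute t p := inv_mul_eq_one.1 hcomm
  apply h.orderOf_ne_fourteen (g := t * p) (v := v)
  · change t (p v) = v
    rw [hpv, htv]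
  · rw [hc.orderOf_mul_eq_mul_orderOf_of_coprime (by rw [ht, hp]; norm_num), ht, hp]

/-- The sign of the permutation of the vertices underlying an automorphism. -/
def isoSign (Γ : SimpleGraph V) : (Γ ≃g Γ) →* ℤˣ :=
  Equiv.Perm.sign.comp (MulAction.toPermHom (Γ ≃g Γ) V)

/-- One fixed vertex leaves (99 - 1)/2 = 49 transpositions. -/
theorem IsSRGWith.isoSign_involution (h : Γ.IsSRGWith 99 14 1 2) {t : Γ ≃g Γ}
    (ht : orderOf t = 2) : isoSign Γ t = -1 := by
  have ht2 : t ^ 2 = 1 := by rw [← ht]; exact pow_orderOf_eq_one t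
  have ht1 : t ≠ 1 := by
    rintro rfl
    rw [orderOf_one] at ht
    norm_num at ht
  have hfix := (h.involution_fixedCount ht2 ht1).1
  have hsq : (MulAction.toPermHom (Γ ≃g Γ) V t) ^ 2 = 1 := by rw [← map_pow, ht2, map_one]
  have hcard : Fintype.card (Function.fixedPoints (MulAction.toPermHom (Γ ≃g Γ) V t)) = 1 := by
    rw [← hfix, fixedCount, ← Fintype.card_subtype]
    rfl
  change Equiv.Perm.sign (MulAction.toPermHom (Γ ≃g Γ) V t) = -1
  rw [Equiv.Perm.sign_of_pow_two_eq_one hsq, h.card, hcard]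
  norm_num

/-- If `7` divides the order of the automorphism group, this order is odd. -/
theorem IsSRGWith.not_two_dvd_card (h : Γ.IsSRGWith 99 14 1 2) (h7 : 7 ∣ Nat.card (Γ ≃g Γ)) :
    ¬ 2 ∣ Nat.card (Γ ≃g Γ) := by
  intro h2
  have : Fact (Nat.Prime 7) := ⟨by norm_num⟩
  have : Fact (Nat.Prime 2) := ⟨Nat.prime_two⟩
  obtain ⟨t, ht⟩ := exists_prime_orderOf_dvd_card' 2 h2
  let P : Sylow 7 (Γ ≃g Γ) := default
  have hPcard := h.card_sylow_seven h7 P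
  obtain ⟨v, hv⟩ := h.exists_fixed_sylow P
  obtain ⟨⟨p, hpP⟩, hp⟩ := exists_prime_orderOf_dvd_card' (G := P) 7 (by rw [hPcard])
  rw [Subgroup.orderOf_mk] at hp
  have hp7 : p ^ 7 = 1 := by rw [← hp]; exact pow_orderOf_eq_one p
  have hp1 : p ≠ 1 := by
    rintro rfl
    rw [orderOf_one] at hp
    norm_num at hp
  have hodd : ∀ (x : Γ ≃g Γ) (n : ℕ), n % 2 = 1 → x ^ n = 1 → isoSign Γ x = 1 := by
    intro x n hn hx
    have h1 : isoSign Γ x ^ n = 1 := by rw [← map_pow, hx, map_one]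
    rwa [Int.units_pow_eq_pow_mod_two, hn, pow_one] at h1
  have hPN : (P : Subgroup (Γ ≃g Γ)) ≤ (isoSign Γ).ker := by
    intro x hx
    rw [MonoidHom.mem_ker]
    refine hodd x 7 (by norm_num) ?_
    have h1 : (⟨x, hx⟩ : P) ^ Nat.card P = 1 := pow_card_eq_one'
    rw [hPcard] at h1
    exact congrArg Subtype.val h1
  -- Frattini argument: the normalizer of `P` and the kernel of the sign generate the group, so an
  -- odd permutation normalizes `P`.
  have hfrat := P.normalizer_sup_eq_top' hPN
  obtain ⟨m, hmP, hm⟩ : ∃ m ∈ Subgroup.normalizer (P : Set (Γ ≃g Γ)), isoSign Γ m ≠ 1 := by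
    by_contra hcon
    push Not at hcon
    have hle : Subgroup.normalizer (P : Set (Γ ≃g Γ)) ≤ (isoSign Γ).ker := fun m hm =>
      MonoidHom.mem_ker.2 (hcon m hm)
    have htop : (isoSign Γ).ker = ⊤ := by
      rw [← hfrat]
      exact (sup_eq_right.2 hle).symm
    have h1 : t ∈ (isoSign Γ).ker := by rw [htop]; trivial
    rw [MonoidHom.mem_ker, h.isoSign_involution ht] at h1
    exact absurd h1 (by decide)
  have heven : 2 ∣ orderOf m := by
    by_contra hcon
    exact hm (hodd m (orderOf m) (by omega) (pow_orderOf_eq_one m))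
  have hs := orderOf_pow_orderOf_div (isOfFinOrder_of_finite m).orderOf_pos.ne' heven
  set s := m ^ (orderOf m / 2) with hsdef
  have hsP : s ∈ Subgroup.normalizer (P : Set (Γ ≃g Γ)) := Subgroup.pow_mem _ hmP _
  have hsinv : s⁻¹ ∈ Subgroup.normalizer (P : Set (Γ ≃g Γ)) := Subgroup.inv_mem _ hsP
  have hconj : s⁻¹ * p * s ∈ P := by
    have := (Subgroup.mem_normalizer_iff.1 hsinv p).1 hpP
    rwa [inv_inv] at this
  -- Since `s` normalizes `P`, it moves the fixed vertex of `P` to a fixed vertex of `p`, which is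
  -- unique.
  have hpsv : p (s v) = s v := by
    have h1 : (s * (s⁻¹ * p * s)) v = s v := congrArg s (hv _ hconj)
    have h2 : s * (s⁻¹ * p * s) = p * s := by group
    rw [h2] at h1
    exact h1
  exact h.not_involution_fixed hs hp (h.eq_of_fixed_of_pow_seven hp7 hp1 hpsv (hv p hpP))
    (hv p hpP)

theorem IsSRGWith.not_five_dvd_card (h : Γ.IsSRGWith 99 14 1 2) : ¬ 5 ∣ Nat.card (Γ ≃g Γ) := by
  intro h5
  have : Fact (Nat.Prime 5) := ⟨by norm_num⟩
  obtain ⟨g, hg⟩ := exists_prime_orderOf_dvd_card' 5 h5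
  have := h.eq_one_of_pow_five (g := g) (by rw [← hg]; exact pow_orderOf_eq_one g)
  rw [this, orderOf_one] at hg
  norm_num at hg

theorem IsSRGWith.eq_eleven_of_prime_dvd_card (h : Γ.IsSRGWith 99 14 1 2) {q : ℕ} (hq : q.Prime)
    (hq7 : 7 < q) (hdvd : q ∣ Nat.card (Γ ≃g Γ)) : q = 11 := by
  have : Fact q.Prime := ⟨hq⟩
  obtain ⟨g, hg⟩ := exists_prime_orderOf_dvd_card' q hdvd
  refine h.prime_dvd_of_pow_prime hq7 (g := g) (by rw [← hg]; exact pow_orderOf_eq_one g) ?_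
  rintro rfl
  rw [orderOf_one] at hg
  exact hq.one_lt.ne hg

/-- An invariant set of vertices avoiding the fixed vertex has cardinality divisible by `7`. -/
theorem IsSRGWith.seven_dvd_card (h : Γ.IsSRGWith 99 14 1 2) {p : Γ ≃g Γ} (hp : orderOf p = 7)
    {v : V} (hpv : p v = v) (s : Finset V) (hs : ∀ x ∈ s, p x ∈ s) (hvs : v ∉ s) :
    7 ∣ s.card := by
  have : Fact (Nat.Prime 7) := ⟨by norm_num⟩
  have hp7 : p ^ 7 = 1 := by rw [← hp]; exact pow_orderOf_eq_one p
  have hp1 : p ≠ 1 := by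
    rintro rfl
    rw [orderOf_one] at hp
    norm_num at hp
  have key := Finset.card_modEq_card_filter_fixed (p := 7) p s hs
    (by intro x _; rw [iterate_iso, hp7]; rfl)
  have h0 : (s.filter fun x => p x = x) = ∅ := by
    rw [Finset.filter_eq_empty_iff]
    intro x hx hpx
    exact hvs (h.eq_of_fixed_of_pow_seven hp7 hp1 hpv hpx ▸ hx)
  rw [h0, Finset.card_empty] at key
  exact Nat.modEq_zero_iff_dvd.1 key

/-- No element of order `3` commutes with an element of order `7` and shares its fixed vertex. -/
theorem IsSRGWith.not_commute_three (h : Γ.IsSRGWith 99 14 1 2) {p x : Γ ≃g Γ}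
    (hp : orderOf p = 7) (hx : orderOf x = 3) (hc : Commute x p) {v : V} (hpv : p v = v)
    (hxv : x v = v) : False := by
  have : Fact (Nat.Prime 3) := ⟨Nat.prime_three⟩
  have hx3 : x ^ 3 = 1 := by rw [← hx]; exact pow_orderOf_eq_one x
  have h1 := h.fixedDeg_modEq x hx3 hxv
  have h2 := h.even_fixedDeg x hxv
  have h3 := h.fixedDeg_le x v
  have h4 : fixedDeg x v ≠ 14 := by
    intro h4
    rw [h.eq_one_of_fixedDeg x hxv h4, orderOf_one] at hx
    norm_num at hx
  have h5 : 7 ∣ fixedDeg x v := by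
    refine h.seven_dvd_card hp hpv _ ?_ (by simp)
    intro y hy
    simp only [Finset.mem_filter, Finset.mem_univ, true_and] at hy ⊢
    have h6 := p.map_rel_iff.2 hy.1
    rw [hpv] at h6
    refine ⟨h6, ?_⟩
    change (x * p) y = p y
    rw [hc.eq]
    change p (x y) = p y
    rw [hy.2]
  rw [Nat.ModEq] at h1
  rw [Nat.even_iff] at h2
  omega

open Classical in
/-- In odd order, the stabilizer acts faithfully on an orbit of seven neighbours. -/
theorem IsSRGWith.card_stabilizer_dvd_factorial (h : Γ.IsSRGWith 99 14 1 2)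
    (hodd : ¬ 2 ∣ Nat.card (Γ ≃g Γ)) {p : Γ ≃g Γ} (hp : orderOf p = 7) {v : V} (hpv : p v = v) :
    Nat.card (MulAction.stabilizer (Γ ≃g Γ) v) ∣ Nat.factorial 7 := by
  set H := MulAction.stabilizer (Γ ≃g Γ) v with hH
  have hHv : ∀ x ∈ H, x v = v := fun x hx => hx
  obtain ⟨a, ha⟩ := h.exists_adj v
  set O : Set V := MulAction.orbit H a with hO
  have hOv : ∀ y ∈ O, Γ.Adj v y := by
    rintro y ⟨x, rfl⟩
    have := x.1.map_rel_iff.2 ha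
    rw [hHv _ x.2] at this
    exact this
  have hOH : ∀ x ∈ H, ∀ y ∈ O, x y ∈ O := by
    rintro x hx y ⟨w, rfl⟩
    exact ⟨⟨x, hx⟩ * w, rfl⟩
  -- The orbit length is an odd multiple of 7, positive and at most 14.
  have hncard : O.toFinset.card = 7 := by
    have h1 : O.toFinset.card ∣ Nat.card (Γ ≃g Γ) := by
      rw [← Set.ncard_eq_toFinset_card', hO, ← MulAction.index_stabilizer]
      exact (Subgroup.index_dvd_card _).trans (Subgroup.card_subgroup_dvd_card H)
    have h2 : 7 ∣ O.toFinset.card := by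
      refine h.seven_dvd_card hp hpv _ ?_ ?_
      · intro y hy
        rw [Set.mem_toFinset] at hy ⊢
        exact hOH p hpv y hy
      · rw [Set.mem_toFinset]
        exact fun hv => Γ.irrefl (hOv v hv)
    have h3 : O.toFinset.card ≤ 14 := by
      rw [← h.card_adj v]
      apply Finset.card_le_card
      intro y hy
      simpa using hOv y (Set.mem_toFinset.1 hy)
    have h4 : 0 < O.toFinset.card :=
      Finset.card_pos.2 ⟨a, Set.mem_toFinset.2 (MulAction.mem_orbit_self a)⟩
    have h5 : ¬ 2 ∣ O.toFinset.card := fun h5 => hodd (h5.trans h1)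
    omega
  -- One partner inside the orbit would put all partners inside, a fixed-point-free pairing of seven
  -- elements. Hence `O` and its partners exhaust the neighbours of `v`, which gives faithfulness.
  have hthird : ∀ y ∈ O, Γ.third v y ∉ O := by
    intro y hy hty
    have hclosed : ∀ w ∈ O.toFinset, Γ.third v w ∈ O.toFinset := by
      intro w hw
      rw [Set.mem_toFinset] at hw ⊢
      obtain ⟨x, rfl⟩ : ∃ x : H, x • y = w := by
        have : w ∈ MulAction.orbit H y := by
          rw [MulAction.orbit_eq_iff.2 hy]; exact hw
        exact this
      have h1 := h.map_third x.1 (hOv y hy)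
      rw [hHv _ x.2] at h1
      change Γ.third v (x.1 y) ∈ O
      rw [← h1]
      exact hOH _ x.2 _ hty
    have : Fact (Nat.Prime 2) := ⟨Nat.prime_two⟩
    have key := Finset.card_modEq_card_filter_fixed (p := 2) (fun w => Γ.third v w) O.toFinset
      hclosed (fun w hw => h.third_third (hOv w (Set.mem_toFinset.1 hw)))
    have h0 : (O.toFinset.filter fun w => Γ.third v w = w) = ∅ := by
      rw [Finset.filter_eq_empty_iff]
      intro w hw hw'
      exact (h.third_spec (hOv w (Set.mem_toFinset.1 hw))).2.ne hw'.symm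
    rw [h0, hncard, Finset.card_empty] at key
    exact absurd key (by decide)
  have hinj : Function.Injective (MulAction.toPermHom H O) := by
    rw [injective_iff_map_eq_one]
    intro x hx
    have hfix : ∀ y ∈ O, x.1 y = y := by
      intro y hy
      have h1 : MulAction.toPermHom H O x ⟨y, hy⟩ = ⟨y, hy⟩ := by rw [hx]; rfl
      exact congrArg Subtype.val h1
    apply Subtype.ext
    refine h.eq_one_of_fixedDeg x.1 (hHv _ x.2) (le_antisymm (h.fixedDeg_le _ _) ?_)
    have hdisj : Disjoint O.toFinset (O.toFinset.image fun y => Γ.third v y) := by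
      rw [Finset.disjoint_right]
      intro w hw hw'
      obtain ⟨y, hy, rfl⟩ := Finset.mem_image.1 hw
      exact hthird y (Set.mem_toFinset.1 hy) (Set.mem_toFinset.1 hw')
    have hcard : (O.toFinset ∪ O.toFinset.image fun y => Γ.third v y).card = 14 := by
      rw [Finset.card_union_of_disjoint hdisj, Finset.card_image_of_injOn, hncard]
      intro y hy w hw hyw
      have h1 := h.third_third (hOv y (Set.mem_toFinset.1 hy))
      have h2 := h.third_third (hOv w (Set.mem_toFinset.1 hw))
      have hyw' : Γ.third v y = Γ.third v w := hyw
      rw [← h1, ← h2, hyw']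
    rw [← hcard]
    apply Finset.card_le_card
    intro w hw
    simp only [Finset.mem_filter, Finset.mem_univ, true_and]
    rcases Finset.mem_union.1 hw with hw | hw
    · rw [Set.mem_toFinset] at hw
      exact ⟨hOv w hw, hfix w hw⟩
    · obtain ⟨y, hy, rfl⟩ := Finset.mem_image.1 hw
      rw [Set.mem_toFinset] at hy
      refine ⟨(h.third_spec (hOv y hy)).1, ?_⟩
      rw [h.map_third x.1 (hOv y hy), hHv _ x.2, hfix y hy]
  have hdvd := Subgroup.card_dvd_of_injective _ hinj
  rwa [Nat.card_perm, Nat.card_eq_card_toFinset, hncard] at hdvd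

theorem IsSRGWith.card_stabilizer_dvd (h : Γ.IsSRGWith 99 14 1 2)
    (hodd : ¬ 2 ∣ Nat.card (Γ ≃g Γ)) {p : Γ ≃g Γ} (hp : orderOf p = 7) {v : V} (hpv : p v = v) :
    Nat.card (MulAction.stabilizer (Γ ≃g Γ) v) ∣ 21 := by
  have hfact := h.card_stabilizer_dvd_factorial hodd hp hpv
  set H := MulAction.stabilizer (Γ ≃g Γ) v with hH
  have hHG : Nat.card H ∣ Nat.card (Γ ≃g Γ) := Subgroup.card_subgroup_dvd_card H
  have hpH : p ∈ H := hpv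
  have h7 : 7 ∣ Nat.card H := by rw [← hp]; exact Subgroup.orderOf_dvd_natCard H hpH
  -- 7! = 2⁴ · 5 · 63.
  have h63 : Nat.card H ∣ 63 := by
    have hc2 : Nat.Coprime (Nat.card H) 2 :=
      ((Nat.Prime.coprime_iff_not_dvd Nat.prime_two).2 fun h2 => hodd (h2.trans hHG)).symm
    have hc5 : Nat.Coprime (Nat.card H) 5 :=
      ((Nat.Prime.coprime_iff_not_dvd (by norm_num)).2
        fun h5 => h.not_five_dvd_card (h5.trans hHG)).symm
    have hc : Nat.Coprime (Nat.card H) (2 ^ 4 * 5) := (hc2.pow_right 4).mul_right hc5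
    refine hc.dvd_of_dvd_mul_right (m := 63) ?_
    exact hfact
  have hne : Nat.card H ≠ 63 := by
    intro hcard
    have : Fact (Nat.Prime 7) := ⟨by norm_num⟩
    have : Fact (Nat.Prime 3) := ⟨Nat.prime_three⟩
    have hcard' : Nat.card H = 7 * 9 := hcard
    have hdiv : ∀ d, d ∣ 9 → d % 7 = 1 → d = 1 := by
      intro d hd hd1
      have := Nat.le_of_dvd (by norm_num) hd
      interval_cases d <;> omega
    let p' : H := ⟨p, hpH⟩
    have hp' : orderOf p' = 7 := by rw [Subgroup.orderOf_mk]; exact hp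
    have hpgroup : IsPGroup 7 (Subgroup.zpowers p') :=
      IsPGroup.of_card (n := 1) (by rw [Nat.card_zpowers, hp', pow_one])
    obtain ⟨P, hP⟩ := hpgroup.exists_le_sylow
    have hnormal := P.normal_of_card_eq hcard' (by norm_num) hdiv
    have hPcard := (P.card_and_index_of_card_eq hcard' (by norm_num)).1
    have hp'P : p' ∈ (P : Subgroup H) := hP (Subgroup.mem_zpowers p')
    obtain ⟨Q, hQ⟩ := Sylow.exists_subgroup_card_pow_prime (G := H) 3 (n := 2)
      (by rw [hcard]; norm_num)
    -- Nine elements of a Sylow 3-subgroup conjugate `p'` into only six nonidentity elements of the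
    -- normal subgroup `P`; a coincidence yields an element of 3-power order centralizing `p'`.
    have hnotinj : ¬ Function.Injective (fun q : Q =>
        (⟨⟨q.1 * p' * q.1⁻¹, hnormal.conj_mem _ hp'P _⟩, by
          intro h1
          have h2 : q.1 * p' * q.1⁻¹ = 1 := congrArg Subtype.val h1
          rw [conj_eq_one_iff] at h2
          rw [h2, orderOf_one] at hp'
          norm_num at hp'⟩ : {x : (P : Subgroup H) // x ≠ 1})) := by
      intro hinj
      have hle := Nat.card_le_card_of_injective _ hinj
      have hcompl : Nat.card {x : (P : Subgroup H) // x ≠ 1} = 6 := by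
        have := Fintype.ofFinite (P : Subgroup H)
        have := Classical.decEq (P : Subgroup H)
        rw [Nat.card_eq_fintype_card, Fintype.card_subtype_compl, Fintype.card_subtype_eq,
          ← Nat.card_eq_fintype_card, hPcard]
      rw [hQ, hcompl] at hle
      norm_num at hle
    rw [Function.Injective] at hnotinj
    push Not at hnotinj
    obtain ⟨q₁, q₂, hq, hne⟩ := hnotinj
    have hq' : q₁.1 * p' * q₁.1⁻¹ = q₂.1 * p' * q₂.1⁻¹ :=
      congrArg (fun x => x.1.1) hq
    set r : Q := q₁⁻¹ * q₂ with hr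
    have hr1 : r ≠ 1 := fun h1 => hne (inv_mul_eq_one.1 h1)
    have hrp : Commute r.1 p' := by
      change (q₁.1⁻¹ * q₂.1) * p' = p' * (q₁.1⁻¹ * q₂.1)
      calc (q₁.1⁻¹ * q₂.1) * p' = q₁.1⁻¹ * (q₂.1 * p' * q₂.1⁻¹) * q₂.1 := by group
        _ = q₁.1⁻¹ * (q₁.1 * p' * q₁.1⁻¹) * q₂.1 := by rw [hq']
        _ = p' * (q₁.1⁻¹ * q₂.1) := by group
    obtain ⟨m, hm⟩ := exists_pow_orderOf_eq_prime_of_pow (k := 2) Nat.prime_three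
      (show r ^ 3 ^ 2 = 1 by rw [← hQ]; exact pow_card_eq_one') hr1
    refine h.not_commute_three hp (x := ((r ^ m : Q) : H).1) ?_ ?_ hpv ((r ^ m : Q) : H).2
    · rw [Subgroup.orderOf_coe, Subgroup.orderOf_coe, hm]
    · have h1 : Commute ((r ^ m : Q) : H) p' := by
        rw [Subgroup.coe_pow]
        exact hrp.pow_left m
      exact congrArg Subtype.val h1.eq
  have hle := Nat.le_of_dvd (by norm_num) h63
  obtain ⟨k, hk⟩ := h7
  obtain ⟨l, hl⟩ := h63
  rw [hk] at hle hl hne ⊢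
  have hk9 : k ≤ 9 := by omega
  interval_cases k <;> omega

/-- The group orders `11 * 63` and `11 * 189` are impossible. -/
theorem IsSRGWith.card_ne_of_eleven (h : Γ.IsSRGWith 99 14 1 2) {p : Γ ≃g Γ} (hp : orderOf p = 7)
    {v : V} (hpv : p v = v) {m : ℕ} (hm : m = 63 ∨ m = 189) :
    Nat.card (Γ ≃g Γ) ≠ 11 * m := by
  intro hcard
  have : Fact (Nat.Prime 11) := ⟨by norm_num⟩
  have : Fact (Nat.Prime 7) := ⟨by norm_num⟩
  have hp7 : p ^ 7 = 1 := by rw [← hp]; exact pow_orderOf_eq_one p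
  have hp1 : p ≠ 1 := by
    rintro rfl
    rw [orderOf_one] at hp
    norm_num at hp
  have hnd : ¬ 11 ∣ m := by rcases hm with rfl | rfl <;> norm_num
  -- This makes the Sylow 11-subgroup normal.
  have hdiv : ∀ d, d ∣ m → d % 11 = 1 → d = 1 := by
    rintro d ⟨e, he⟩ hd
    obtain ⟨k, rfl⟩ : ∃ k, d = 11 * k + 1 := ⟨d / 11, by omega⟩
    have hk : k ≤ 17 := by
      by_contra hk
      have h1 : 1 ≤ e := Nat.one_le_iff_ne_zero.2 (by rintro rfl; omega)
      have := Nat.mul_le_mul_left (11 * k + 1) h1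
      omega
    interval_cases k <;> omega
  let Q : Sylow 11 (Γ ≃g Γ) := default
  have hnormal := Q.normal_of_card_eq hcard hnd hdiv
  have hQcard := (Q.card_and_index_of_card_eq hcard hnd).1
  classical
  have := Fintype.ofFinite (Γ ≃g Γ)
  have hs : (Finset.univ.filter fun x => x ∈ (Q : Subgroup (Γ ≃g Γ))).card = 11 := by
    rw [← Fintype.card_subtype, ← Nat.card_eq_fintype_card]
    exact hQcard
  have hiter : ∀ (n : ℕ) (x : Γ ≃g Γ), (fun x => p * x * p⁻¹)^[n] x = p ^ n * x * (p ^ n)⁻¹ := by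
    intro n
    induction n with
    | zero => intro x; simp
    | succ k ih =>
      intro x
      rw [Function.iterate_succ_apply', ih, pow_succ']
      group
  have key := Finset.card_modEq_card_filter_fixed (p := 7) (fun x => p * x * p⁻¹)
    (Finset.univ.filter fun x => x ∈ (Q : Subgroup (Γ ≃g Γ)))
    (by
      intro x hx
      simp only [Finset.mem_filter, Finset.mem_univ, true_and] at hx ⊢
      exact hnormal.conj_mem x hx p)
    (by
      intro x _
      rw [hiter, hp7]
      simp)
  rw [hs, Nat.ModEq] at key
  -- Conjugation by `p` fixes 4 modulo 7 of the 11 elements, so it centralizes a nontrivial one.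
  obtain ⟨q, hq, hq1⟩ := Finset.exists_mem_ne (s := (Finset.univ.filter fun x =>
    x ∈ (Q : Subgroup (Γ ≃g Γ))).filter fun x => p * x * p⁻¹ = x) (by omega) 1
  simp only [Finset.mem_filter, Finset.mem_univ, true_and] at hq
  have hq11 : q ^ 11 = 1 := by
    have h1 : (⟨q, hq.1⟩ : Q) ^ Nat.card Q = 1 := pow_card_eq_one'
    rw [hQcard] at h1
    exact congrArg Subtype.val h1
  have hcomm : p * q = q * p := mul_inv_eq_iff_eq_mul.1 hq.2
  have hpq : p (q v) = q v := by
    change (p * q) v = q v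
    rw [hcomm]
    change q (p v) = q v
    rw [hpv]
  exact h.not_fixed_of_pow_prime (by norm_num) hq11 hq1 v
    (h.eq_of_fixed_of_pow_seven hp7 hp1 hpq hpv)

theorem IsSRGWith.card_iso_dvd (h : Γ.IsSRGWith 99 14 1 2) (h7 : 7 ∣ Nat.card (Γ ≃g Γ)) :
    Nat.card (Γ ≃g Γ) ∣ 21 := by
  classical
  have : Fact (Nat.Prime 7) := ⟨by norm_num⟩
  have hodd := h.not_two_dvd_card h7
  obtain ⟨p, hp⟩ := exists_prime_orderOf_dvd_card' 7 h7
  obtain ⟨v, hpv⟩ := h.exists_fixed_of_pow_seven (g := p) (by rw [← hp]; exact pow_orderOf_eq_one p)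
  have hstab := h.card_stabilizer_dvd hodd hp hpv
  have hmul := (MulAction.stabilizer (Γ ≃g Γ) v).card_mul_index
  have hind : (MulAction.stabilizer (Γ ≃g Γ) v).index =
      (MulAction.orbit (Γ ≃g Γ) v).toFinset.card := by
    rw [MulAction.index_stabilizer, Set.ncard_eq_toFinset_card']
  have h7s : 7 ∣ Nat.card (MulAction.stabilizer (Γ ≃g Γ) v) := by
    rw [← hp]; exact Subgroup.orderOf_dvd_natCard _ hpv
  set n := (MulAction.stabilizer (Γ ≃g Γ) v).index with hn
  have hvO : v ∈ (MulAction.orbit (Γ ≃g Γ) v).toFinset :=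
    Set.mem_toFinset.2 (MulAction.mem_orbit_self v)
  have hmod : 7 ∣ n - 1 := by
    rw [hind, ← Finset.card_erase_of_mem hvO]
    refine h.seven_dvd_card hp hpv _ ?_ (Finset.notMem_erase _ _)
    intro x hx
    rw [Finset.mem_erase, Set.mem_toFinset] at hx ⊢
    refine ⟨fun h1 => hx.1 (p.injective (h1.trans hpv.symm)), ?_⟩
    exact MulAction.mem_orbit_of_mem_orbit p hx.2
  have hle : n ≤ 99 := by
    rw [hind, ← h.card]
    exact Finset.card_le_univ _
  have hpos : 0 < n := by
    rw [hind]
    exact Finset.card_pos.2 ⟨v, hvO⟩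
  have hdvd : n ∣ Nat.card (Γ ≃g Γ) := ⟨_, by rw [← hmul, mul_comm]⟩
  have h2 : ¬ 2 ∣ n := fun h2 => hodd (h2.trans hdvd)
  have h5 : ¬ 5 ∣ n := fun h5 => h.not_five_dvd_card (h5.trans hdvd)
  have hq : ∀ q, q.Prime → 7 < q → q ≠ 11 → n ≠ q := fun q hq h7q h11 hnq =>
    h11 (h.eq_eleven_of_prime_dvd_card hq h7q (hnq ▸ hdvd))
  have h29 := hq 29 (by norm_num) (by norm_num) (by norm_num)
  have h43 := hq 43 (by norm_num) (by norm_num) (by norm_num)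
  have h71 := hq 71 (by norm_num) (by norm_num) (by norm_num)
  have h57 : n ≠ 57 := fun h57 => absurd
    (h.eq_eleven_of_prime_dvd_card (q := 19) (by norm_num) (by norm_num)
      ((by rw [h57]; norm_num : 19 ∣ n).trans hdvd)) (by norm_num)
  -- The odd numbers up to 99 that are 1 modulo 7 are 1, 15, 29, 43, 57, 71, 85 and 99.
  have hcase : n = 1 ∨ n = 99 := by omega
  rcases hcase with h1 | h99
  · rw [h1, mul_one] at hmul
    rw [← hmul]
    exact hstab
  · exfalso
    rw [h99] at hmul
    have hle21 := Nat.le_of_dvd (by norm_num) hstab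
    obtain ⟨k, hk⟩ := h7s
    obtain ⟨l, hl⟩ := hstab
    rw [hk] at hle21 hl hmul
    have hk3 : k ≤ 3 := by omega
    interval_cases k
    · omega
    · exact h.card_ne_of_eleven hp hpv (m := 63) (Or.inl rfl) hmul.symm
    · omega
    · exact h.card_ne_of_eleven hp hpv (m := 189) (Or.inr rfl) hmul.symm

end Group

end SimpleGraph

theorem proposition4p3 {V : Type*} [Fintype V] (Γ : SimpleGraph V) [DecidableRel Γ.Adj]
    (hΓ : Γ.IsSRGWith 99 14 1 2) (h7 : 7 ∣ Nat.card (Γ ≃g Γ)) :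
    Nat.card (Γ ≃g Γ) ∣ 21 := by
  classical
  exact hΓ.card_iso_dvd h7
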